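/- Base stations and eavesdroppers form independent homogeneous Poisson point processes $\Phi_B$, $\Phi_E$ on $\mathbb{R}^2$ with intensities $\lambda_B,\lambda_E>0$; the typical user is at the origin $o$. Each link is, independently of the others, line-of-sight (type $L$) with probability $C\in[0,1]$ if its length is at most $D>0$ and with probability $0$ otherwise, and non-line-of-sight (type $N$) in the remaining case. A link of type $j\in\{L,N\}$ and length $r$ has path loss $C_jr^{-\alpha_j}$ with $C_j>0$, $\alpha_L>0$, $\alpha_N>2$, and an independent small-scale channel gain distributed as $\mathrm{gamma}(N_j,1)$ (shape $N_j$, scale $1$), $N_j\ge 1$ an integer. Write $L(x,y)$ for the path loss of the link from $x$ to $y$, $h_{xo}$ for the channel gain from the base station $x$ to the user, and $g_{xz}$ for that from $x$ to the eavesdropper $z$. The user is served by $x^*=\arg\max_{x\in\Phi_B}L(x,o)$ with antenna gain $M_s>0$. For each eavesdropper an angle $\theta$ is drawn independently and uniformly from $[-180^\circ,180^\circ]$; the antenna gain towards it is $G_b(\theta)=M_s$ if $|\theta|\le\theta_b$ and $G_b(\theta)=m_s>0$ otherwise, where $0\le\theta_b\le 180$, so that the main lobe (gain $M_s$) has probability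 $\Pr_{G_b}(M_s)=\theta_b/180$ and the side lobe (gain $m_s$) has probability $\Pr_{G_b}(m_s)=(180-\theta_b)/180$. Sums over $V\in\{M_s,m_s\}$ below run over these two lobes. Let $$I_E=\sum_{z\in\Phi_E}G_b(\theta)L(x^*,z)g_{x^*z},\qquad \tau_c=\Pr\left(\frac{M_sL(x^*,o)h_{x^*o}}{I_E}\ge 1\right).$$ Let $A_j$ be the probability that the link from $x^*$ to $o$ is of type $j$, let $r_j$ have the conditional law of $\|x^*\|$ given that this link is of type $j$ (a term with $A_j=0$ is read as $0$), and let $q_L=C$, $q_N=1-C$. For $s>0$ put $$\Xi(s)=-s\Bigg(2\pi\lambda_E\sum_{j\in\{L,N\}}q_j\sum_{V\in\{M_s,m_s\}}\Pr\nolimits_{G_b}(V)\frac{(VC_j)^{2/\alpha_j}}{\alpha_j}\sum_{m=0}^{N_j-1}\frac{(D^{\alpha_j}/(VC_j))^{m+2/\alpha_j}}{(m+\frac{2}{\alpha_j})(s+D^{\alpha_j}/(VC_j))^{m+1}}\,{}_2F_1\Big(1,m+1;m+\tfrac{2}{\alpha_j}+1;\tfrac{D^{\alpha_j}/(VC_j)}{D^{\alpha_j}/(VC_j)+s}\Big)$$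 $$\qquad+2\pi\lambda_E\sum_{V\in\{M_s,m_s\}}\Pr\nolimits_{G_b}(V)\frac{(VC_N)^{2/\alpha_N}}{\alpha_N}\sum_{m=0}^{N_N-1}\frac{(D^{\alpha_N}/(VC_N))^{m+2/\alpha_N}}{(1-\frac{2}{\alpha_N})(s+D^{\alpha_N}/(VC_N))^{m+1}}\,{}_2F_1\Big(1,m+1;2-\tfrac{2}{\alpha_N};\tfrac{s}{s+D^{\alpha_N}/(VC_N)}\Big)\Bigg),$$ where ${}_2F_1$ is the Gauss hypergeometric function. Then $I_E<\infty$ almost surely; the Laplace transform of $I_E$ is $\mathbb{E}(e^{-sI_E})=\mathcal{L}_{I_E}(s):=\exp(\Xi(s))$ for all $s>0$; $\mathcal{L}_{I_E}$ is smooth on $(0,\infty)$; and $$\tau_c=\sum_{j\in\{L,N\}}\mathbb{E}_{r_j}\left[\sum_{m=0}^{N_j-1}\left(\frac{r_j^{\alpha_j}}{M_sC_j}\right)^m\frac{A_j}{\Gamma(m+1)}(-1)^m\mathcal{L}^{(m)}_{I_E}\left(\frac{r_j^{\alpha_j}}{M_sC_j}\right)\right],$$ where the expectations exist (the integrands are integrable).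 -/

import Mathlib

open MeasureTheory ProbabilityTheory Set Filter Topology
open scoped ENNReal NNReal

namespace MmWave

/-- The Euclidean plane in which base stations and eavesdroppers are located. -/
abbrev Plane : Type := EuclideanSpace ℝ (Fin 2)

/-- A link is either line-of-sight (`los`, written `L`) or non-line-of-sight (`nlos`, `N`). -/
inductive LinkType : Type
  | los
  | nlos
  deriving DecidableEq

instance : Fintype LinkType := ⟨{LinkType.los, LinkType.nlos}, fun j => by cases j <;> decide⟩

/-- The two sectors of the antenna pattern: main lobe and side lobe. -/
inductive Lobe : Type
  | main
  | side
  deriving DecidableEq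

instance : Fintype Lobe := ⟨{Lobe.main, Lobe.side}, fun V => by cases V <;> decide⟩

/-- The parameters of the network. -/
structure Params where
  /-- intensity `λ_B` of the base stations -/
  lamB : ℝ
  /-- intensity `λ_E` of the eavesdroppers -/
  lamE : ℝ
  /-- array gain `V` of each lobe: `M_s = gain main`, `m_s = gain side` -/
  gain : Lobe → ℝ
  /-- beam width `θ_b` of the main lobe, in degrees -/
  beam : ℝ
  /-- probability `C` that a link of length at most `D` is line-of-sight -/
  C : ℝ
  /-- radius `D` of the line-of-sight ball -/
  D : ℝ
  /-- path loss exponents `α_L`, `α_N` -/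
  alpha : LinkType → ℝ
  /-- path loss intercepts `C_L`, `C_N` -/
  coef : LinkType → ℝ
  /-- Nakagami parameters `N_L`, `N_N` -/
  shape : LinkType → ℕ
  lamB_pos : 0 < lamB
  lamE_pos : 0 < lamE
  gain_pos : ∀ V, 0 < gain V
  beam_nonneg : 0 ≤ beam
  beam_le : beam ≤ 180
  C_nonneg : 0 ≤ C
  C_le_one : C ≤ 1
  D_pos : 0 < D
  alpha_los_pos : 0 < alpha LinkType.los
  two_lt_alpha_nlos : 2 < alpha LinkType.nlos
  coef_pos : ∀ j, 0 < coef j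
  shape_pos : ∀ j, 0 < shape j

namespace Params

noncomputable section

/-- `q_L(r)`: the probability that a link of length `r` is line-of-sight. -/
def losProb (p : Params) (r : ℝ) : ℝ := if r ≤ p.D then p.C else 0

/-- The sectored antenna pattern `G_b(θ)`, with `θ` in degrees. -/
def pattern (p : Params) (θ : ℝ) : ℝ :=
  if |θ| ≤ p.beam then p.gain Lobe.main else p.gain Lobe.side

/-- The path loss `C_j r^{-α_j}` of a link of type `j` and length `r`. -/
def pathLoss (p : Params) (j : LinkType) (r : ℝ) : ℝ := p.coef j * r ^ (-p.alpha j)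

/-- The type of a link of length `r` whose blockage variable is `u`; when `u` is uniform on
`[0, 1]`, the link is line-of-sight with probability `q_L(r)`. -/
def linkType (p : Params) (u r : ℝ) : LinkType :=
  if u < p.losProb r then LinkType.los else LinkType.nlos

/-- `Pr_{G_b}(V)`: `θ_b / 180` for the main lobe, `(180 - θ_b) / 180` for the side lobe. -/
def lobeProb (p : Params) : Lobe → ℝ
  | Lobe.main => p.beam / 180
  | Lobe.side => (180 - p.beam) / 180

/-- `q_L = C` and `q_N = 1 - C`. -/
def q (p : Params) : LinkType → ℝ
  | LinkType.los => p.C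
  | LinkType.nlos => 1 - p.C

/-- The number `D^{α_j} / (V C_j)`. -/
def edge (p : Params) (j : LinkType) (V : Lobe) : ℝ :=
  p.D ^ p.alpha j / (p.gain V * p.coef j)

/-- The exponent `Ξ(s)`. -/
def Xi (p : Params) (s : ℝ) : ℝ :=
  -s * (2 * Real.pi * p.lamE * (∑ j : LinkType, p.q j *
          ∑ V : Lobe, p.lobeProb V * ((p.gain V * p.coef j) ^ (2 / p.alpha j) / p.alpha j) *
            ∑ m ∈ Finset.range (p.shape j),
              p.edge j V ^ ((m : ℝ) + 2 / p.alpha j) /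
                (((m : ℝ) + 2 / p.alpha j) * (s + p.edge j V) ^ (m + 1)) *
              ordinaryHypergeometric (1 : ℝ) ((m : ℝ) + 1) ((m : ℝ) + 2 / p.alpha j + 1)
                (p.edge j V / (p.edge j V + s)))
      + 2 * Real.pi * p.lamE *
          ∑ V : Lobe, p.lobeProb V *
            ((p.gain V * p.coef LinkType.nlos) ^ (2 / p.alpha LinkType.nlos) /
              p.alpha LinkType.nlos) *
            ∑ m ∈ Finset.range (p.shape LinkType.nlos),
              p.edge LinkType.nlos V ^ ((m : ℝ) + 2 / p.alpha LinkType.nlos) /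
                ((1 - 2 / p.alpha LinkType.nlos) * (s + p.edge LinkType.nlos V) ^ (m + 1)) *
              ordinaryHypergeometric (1 : ℝ) ((m : ℝ) + 1) (2 - 2 / p.alpha LinkType.nlos)
                (s / (s + p.edge LinkType.nlos V)))

/-- The closed form `exp (Ξ(s))` of the Laplace transform of the aggregate eavesdropper signal. -/
def expXi (p : Params) (s : ℝ) : ℝ := Real.exp (p.Xi s)

/-- The point `r^{α_j} / (M_s C_j)`. -/
def arg (p : Params) (j : LinkType) (r : ℝ) : ℝ :=
  r ^ p.alpha j / (p.gain Lobe.main * p.coef j)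

/-- The law of the random marks of a link: a blockage variable, uniform on `[0, 1]`, and
independently for each link type `j` a `gamma(N_j, 1)` variable, the small-scale channel gain that
the link has if its type is `j`. -/
def linkLaw (p : Params) : Measure (ℝ × (LinkType → ℝ)) :=
  (ProbabilityTheory.cond volume (Icc (0 : ℝ) 1)).prod (Measure.pi fun j => gammaMeasure (p.shape j) 1)

/-- The law of the random marks of a link towards an eavesdropper: an angle, uniform on
`[-180, 180]` degrees, and independently of it the marks of a link. -/
def eveLinkLaw (p : Params) : Measure (ℝ × (ℝ × (LinkType → ℝ))) :=
  (ProbabilityTheory.cond volume (Icc (-180 : ℝ) 180)).prod p.linkLaw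

end

end Params

noncomputable section

variable {Ω : Type*} [MeasurableSpace Ω]

/-- The number of points of the point process `{X 0, X 1, …}` in the set `A`. -/
def count (X : ℕ → Ω → Plane) (A : Set Plane) (ω : Ω) : ℕ∞ := {n | X n ω ∈ A}.encard

/-- The random points `X 0, X 1, …` form a homogeneous Poisson point process on the plane with
intensity `lam`: the number of points in a set of finite area is Poisson distributed with mean
`lam` times the area, and the numbers of points in disjoint sets are independent. -/
structure IsPoissonProcess (X : ℕ → Ω → Plane) (lam : ℝ) (P : Measure Ω) : Prop where
  measurable : ∀ n, Measurable (X n)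
  count_law : ∀ A : Set Plane, MeasurableSet A → volume A < ∞ → ∀ k : ℕ,
    P {ω | count X A ω = k} = poissonMeasure (lam * volume.real A).toNNReal {k}
  count_indep : ∀ (n : ℕ) (A : Fin n → Set Plane), (∀ i, MeasurableSet (A i)) →
    Pairwise (fun i j => Disjoint (A i) (A j)) → iIndepFun (fun i => count X (A i)) P

/-- A realisation of the network on the probability space `(Ω, P)`. The typical user is at the
origin. -/
structure Network (p : Params) (P : Measure Ω) where
  /-- locations of the base stations -/
  bs : ℕ → Ω → Plane
  /-- locations of the eavesdroppers -/
  eve : ℕ → Ω → Plane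
  /-- marks (blockage, fading) of the link from base station `i` to the typical user -/
  userMark : ℕ → Ω → ℝ × (LinkType → ℝ)
  /-- marks (angle, (blockage, fading)) of the link from base station `k.1` to eavesdropper
  `k.2` -/
  eveMark : ℕ × ℕ → Ω → ℝ × (ℝ × (LinkType → ℝ))
  bs_poisson : IsPoissonProcess bs p.lamB P
  eve_poisson : IsPoissonProcess eve p.lamE P
  userMark_law : ∀ i, HasLaw (userMark i) p.linkLaw P
  userMark_indep : iIndepFun userMark P
  eveMark_law : ∀ k, HasLaw (eveMark k) p.eveLinkLaw P
  eveMark_indep : iIndepFun eveMark P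
  /- The two point processes and the two families of marks are mutually independent. -/
  indep_bs : IndepFun (fun ω i => bs i ω)
    (fun ω => (fun n => eve n ω, fun i => userMark i ω, fun k => eveMark k ω)) P
  indep_eve : IndepFun (fun ω n => eve n ω)
    (fun ω => (fun i => userMark i ω, fun k => eveMark k ω)) P
  indep_marks : IndepFun (fun ω i => userMark i ω) (fun ω k => eveMark k ω) P

namespace Network

variable {p : Params} {P : Measure Ω} (W : Network p P)

/-- The type of the link from base station `i` to the typical user. -/
def userType (i : ℕ) (ω : Ω) : LinkType := p.linkType (W.userMark i ω).1 ‖W.bs i ω‖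

/-- The path loss `L(x_i, o)` of the link from base station `i` to the typical user. -/
def userLoss (i : ℕ) (ω : Ω) : ℝ := p.pathLoss (W.userType i ω) ‖W.bs i ω‖

/-- The index of the serving base station `x* = argmax L(x, o)`. Almost surely the maximum is
attained exactly once. -/
def serving (ω : Ω) : ℕ := sInf {i | ∀ k, W.userLoss k ω ≤ W.userLoss i ω}

/-- The type of the link from the serving base station to the typical user. -/
def servingType (ω : Ω) : LinkType := W.userType (W.serving ω) ω

/-- The distance from the typical user to its serving base station. -/
def servingDist (ω : Ω) : ℝ := ‖W.bs (W.serving ω) ω‖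

/-- The small-scale channel gain `h_{x* o}`. -/
def servingFading (ω : Ω) : ℝ := (W.userMark (W.serving ω) ω).2 (W.servingType ω)

/-- The type of the link from base station `i` to eavesdropper `n`. -/
def eveType (i n : ℕ) (ω : Ω) : LinkType :=
  p.linkType (W.eveMark (i, n) ω).2.1 (dist (W.bs i ω) (W.eve n ω))

/-- The signal `G_b(θ) L(x_i, z_n) g_{x_i z_n}` of base station `i` received by eavesdropper
`n`. -/
def eveSignal (i n : ℕ) (ω : Ω) : ℝ :=
  p.pattern (W.eveMark (i, n) ω).1 *
    p.pathLoss (W.eveType i n ω) (dist (W.bs i ω) (W.eve n ω)) *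
    (W.eveMark (i, n) ω).2.2 (W.eveType i n ω)

/-- The aggregate signal `I_E` of the serving base station received by all eavesdroppers. -/
def IE (ω : Ω) : ℝ≥0∞ := ∑' n, ENNReal.ofReal (W.eveSignal (W.serving ω) n ω)

/-- The secure connectivity probability `τ_c = Pr(M_s L(x*, o) h_{x* o} / I_E ≥ 1)`. -/
def tauC : ℝ :=
  P.real {ω | 1 ≤ ENNReal.ofReal
    (p.gain Lobe.main * W.userLoss (W.serving ω) ω * W.servingFading ω) / W.IE ω}

/-- The Laplace transform `E[exp(-s I_E)]`. -/
def laplaceIE (s : ℝ) : ℝ := ∫ ω, Real.exp (-s * (W.IE ω).toReal) ∂P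

/-- `A_j`: the probability that the link from the serving base station is of type `j`. -/
def assocProb (j : LinkType) : ℝ := P.real {ω | W.servingType ω = j}

/-- The law of `r_j`: the conditional law of the distance from the typical user to its serving
base station, given that the link between them is of type `j`. -/
def distLaw (j : LinkType) : Measure ℝ :=
  (ProbabilityTheory.cond P {ω | W.servingType ω = j}).map W.servingDist

/-- The term of index `j` under the expectation over the serving distance, as a function of
`r_j`. -/
def tauTerm (j : LinkType) (r : ℝ) : ℝ :=
  ∑ m ∈ Finset.range (p.shape j),
    p.arg j r ^ m * (W.assocProb j / Real.Gamma ((m : ℝ) + 1)) * (-1) ^ m *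
      iteratedDeriv m p.expXi (p.arg j r)

end Network

end

end MmWave

/-!
A Poisson point process of intensity `λ` has Laplace functional
`E[exp (-∑ f (X n))] = exp (-λ ∫ (1 - exp (-f)))`: for simple functions `f` of finite measure
support this is the definition of the process, and both sides pass to monotone limits. Averaging
over the independent marks of the links first, the aggregate signal `I` of a base station at a
fixed point `x` satisfies `E[exp (-s I)] = exp (-λ_E ∫ (1 - E[exp (-s S)]))`, where `S` is the
signal at a random eavesdropper. Translation invariance removes `x`, so the transform does not
depend on which base station serves the user. In polar coordinates the exponent is a sum of
incomplete Euler integrals, which integration by parts expands into the hypergeometric series of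
`Ξ`.

Letting `s → 0` shows that `I` is finite. A gamma variable `h` of integer shape `n` satisfies
`Pr(h ≥ y) = exp (-y) ∑_{m < n} y ^ m / m!`. For `y = s I`, this tail has expectation
`∑_{m < n} (-s) ^ m / m! · 𝓛^(m)(s)`, since derivatives of the Laplace transform may be taken under
the expectation; conditioning on the serving base station gives the formula for `τ_c`.
-/

/-! ### Laplace transforms on `[0, ∞]` -/

/-- The function `x ↦ exp (-x)` on `[0, ∞]`, with value `0` at `∞`. Laplace transforms of
`[0, ∞]`-valued random variables are Lebesgue integrals of it. -/
noncomputable def expNeg (x : ℝ≥0∞) : ℝ≥0∞ := (EReal.exp (x : EReal))⁻¹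

@[simp] lemma expNeg_zero : expNeg 0 = 1 := by simp [expNeg]

@[simp] lemma expNeg_top : expNeg ∞ = 0 := by simp [expNeg]

lemma expNeg_ofReal {x : ℝ} (hx : 0 ≤ x) :
    expNeg (ENNReal.ofReal x) = ENNReal.ofReal (Real.exp (-x)) := by
  rw [expNeg, EReal.coe_ennreal_ofReal, max_eq_left hx, EReal.exp_coe, Real.exp_neg,
    ENNReal.ofReal_inv_of_pos (Real.exp_pos x)]

lemma expNeg_eq_ofReal {x : ℝ≥0∞} (hx : x ≠ ∞) :
    expNeg x = ENNReal.ofReal (Real.exp (-x.toReal)) := by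
  rw [← expNeg_ofReal ENNReal.toReal_nonneg, ENNReal.ofReal_toReal hx]

lemma expNeg_add (x y : ℝ≥0∞) : expNeg (x + y) = expNeg x * expNeg y := by
  have h (z : ℝ≥0∞) : EReal.exp (z : EReal) ≠ 0 := by simp
  rw [expNeg, EReal.coe_ennreal_add, EReal.exp_add, ENNReal.mul_inv (Or.inl (h x)) (Or.inr (h y)),
    expNeg, expNeg]

lemma expNeg_sum {ι : Type*} (s : Finset ι) (f : ι → ℝ≥0∞) :
    expNeg (∑ i ∈ s, f i) = ∏ i ∈ s, expNeg (f i) := by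
  classical
  induction s using Finset.induction_on with
  | empty => simp
  | insert a s ha ih => rw [Finset.sum_insert ha, Finset.prod_insert ha, expNeg_add, ih]

lemma expNeg_mul_natCast (x : ℝ≥0∞) (n : ℕ) : expNeg (x * n) = expNeg x ^ n := by
  simpa [mul_comm] using expNeg_sum (Finset.range n) fun _ => x

lemma continuous_expNeg : Continuous expNeg :=
  (ENNReal.continuous_exp.comp continuous_coe_ennreal_ereal).inv

@[fun_prop]
lemma measurable_expNeg : Measurable expNeg := continuous_expNeg.measurable

lemma antitone_expNeg : Antitone expNeg := fun x y h => by
  rw [expNeg, expNeg, ENNReal.inv_le_inv]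
  exact EReal.exp_monotone (by exact_mod_cast h)

lemma expNeg_le_one (x : ℝ≥0∞) : expNeg x ≤ 1 := by
  simpa using antitone_expNeg (zero_le (a := x))

/-- A right inverse of `expNeg` on `[0, 1]`, with value `∞` at `0`. It turns products of Laplace
transforms, which need not converge along infinite families, into sums in `[0, ∞]`. -/
noncomputable def negLog (x : ℝ≥0∞) : ℝ≥0∞ := (ENNReal.log x⁻¹).toENNReal

lemma measurable_negLog : Measurable negLog :=
  (ENNReal.measurable_log.comp measurable_inv).ereal_toENNReal

lemma expNeg_negLog {x : ℝ≥0∞} (hx : x ≤ 1) : expNeg (negLog x) = x := by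
  rw [expNeg, negLog, EReal.coe_toENNReal, ENNReal.exp_log, inv_inv]
  rw [← ENNReal.log_one]
  exact ENNReal.log_monotone (by simpa using hx)

lemma lintegral_expNeg_le_one {α : Type*} [MeasurableSpace α] (μ : Measure α)
    [IsProbabilityMeasure μ] (f : α → ℝ≥0∞) : ∫⁻ a, expNeg (f a) ∂μ ≤ 1 :=
  (lintegral_mono fun a => expNeg_le_one (f a)).trans (by simp)

lemma tendsto_lintegral_expNeg {α ι : Type*} [MeasurableSpace α] {μ : Measure α}
    [IsFiniteMeasure μ] {l : Filter ι} [l.IsCountablyGenerated] {F : ι → α → ℝ≥0∞}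
    {G : α → ℝ≥0∞} (hF : ∀ i, AEMeasurable (F i) μ)
    (h : ∀ a, Tendsto (fun i => F i a) l (𝓝 (G a))) :
    Tendsto (fun i => ∫⁻ a, expNeg (F i a) ∂μ) l (𝓝 (∫⁻ a, expNeg (G a) ∂μ)) :=
  tendsto_lintegral_filter_of_dominated_convergence' (fun _ => 1)
    (Eventually.of_forall fun i => measurable_expNeg.comp_aemeasurable (hF i))
    (Eventually.of_forall fun _ => Eventually.of_forall fun _ => expNeg_le_one _)
    (by simp [measure_ne_top])
    (Eventually.of_forall fun a => (continuous_expNeg.tendsto _).comp (h a))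

lemma tendsto_lintegral_expNeg_mul {α : Type*} [MeasurableSpace α] {μ : Measure α}
    [IsFiniteMeasure μ] {Y : α → ℝ≥0∞} (hY : AEMeasurable Y μ) :
    Tendsto (fun s : ℝ => ∫⁻ a, expNeg (ENNReal.ofReal s * Y a) ∂μ) (𝓝[>] 0)
      (𝓝 (μ {a | Y a ≠ ∞})) := by
  have hlim (a : α) : Tendsto (fun s : ℝ => ENNReal.ofReal s * Y a) (𝓝[>] 0)
      (𝓝 ({a | Y a ≠ ∞}ᶜ.indicator (fun _ => ∞) a)) := by
    by_cases ha : Y a = ∞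
    · refine tendsto_const_nhds.congr' ?_
      filter_upwards [self_mem_nhdsWithin] with s hs
      simp [ha, ENNReal.mul_top, ENNReal.ofReal_eq_zero.not.2 (not_le.2 hs)]
    · simpa [ha] using ENNReal.Tendsto.mul_const
        (ENNReal.continuous_ofReal.continuousWithinAt (s := Ioi 0) (x := 0)).tendsto (Or.inr ha)
  have hind : (fun a => expNeg ({a | Y a ≠ ∞}ᶜ.indicator (fun _ => ∞) a))
      = {a | Y a ≠ ∞}.indicator 1 := by
    ext a
    by_cases ha : Y a = ∞ <;> simp [ha]
  have hnull : NullMeasurableSet {a | Y a ≠ ∞} μ :=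
    hY.nullMeasurable (measurableSet_singleton ∞).compl
  simpa [hind, lintegral_indicator_one₀ hnull] using
    tendsto_lintegral_expNeg (fun s => hY.const_mul _) hlim

lemma lintegral_expNeg_tsum {Ω : Type*} [MeasurableSpace Ω] {P : Measure Ω}
    {Z : ℕ → Ω → ℝ≥0∞} (hZ : ∀ n, Measurable (Z n)) (hind : iIndepFun Z P) :
    ∫⁻ ω, expNeg (∑' n, Z n ω) ∂P = expNeg (∑' n, negLog (∫⁻ ω, expNeg (Z n ω) ∂P)) := by
  have := hind.isProbabilityMeasure
  have partial_sum (N : ℕ) : ∫⁻ ω, expNeg (∑ n ∈ Finset.range N, Z n ω) ∂P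
      = expNeg (∑ n ∈ Finset.range N, negLog (∫⁻ ω, expNeg (Z n ω) ∂P)) := by
    simp only [expNeg_sum, expNeg_negLog (lintegral_expNeg_le_one P _)]
    exact lintegral_prod_eq_prod_lintegral_of_indepFun (Finset.range N) (fun n ω => expNeg (Z n ω))
      (hind.comp (fun _ => expNeg) fun _ => measurable_expNeg)
      (fun n => measurable_expNeg.comp (hZ n))
  refine tendsto_nhds_unique (tendsto_lintegral_expNeg
    (F := fun N ω => ∑ n ∈ Finset.range N, Z n ω) (fun N => by fun_prop)
    fun ω => ENNReal.tendsto_nat_tsum _) ?_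
  simp_rw [partial_sum]
  exact (continuous_expNeg.tendsto _).comp (ENNReal.tendsto_nat_tsum _)

/-! ### Gamma distributions of integer shape -/

/-- The tail `exp (-x) ∑_{m < n} x ^ m / m!` of the gamma distribution of integer shape `n` and
rate `1`. -/
noncomputable def erlangTail (n : ℕ) (x : ℝ) : ℝ :=
  Real.exp (-x) * ∑ m ∈ Finset.range n, x ^ m / m.factorial

lemma continuous_erlangTail (n : ℕ) : Continuous (erlangTail n) := by
  unfold erlangTail; fun_prop

lemma erlangTail_nonneg (n : ℕ) {x : ℝ} (hx : 0 ≤ x) : 0 ≤ erlangTail n x := by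
  unfold erlangTail; positivity

lemma erlangTail_le_one (n : ℕ) {x : ℝ} (hx : 0 ≤ x) : erlangTail n x ≤ 1 := by
  rw [erlangTail, Real.exp_neg]
  exact inv_mul_le_one_of_le₀ (Real.sum_le_exp_of_nonneg hx n) (Real.exp_nonneg x)

lemma erlangTail_succ (n : ℕ) (x : ℝ) :
    erlangTail (n + 1) x = erlangTail n x + Real.exp (-x) * (x ^ n / n.factorial) := by
  rw [erlangTail, Finset.sum_range_succ, mul_add, ← erlangTail]

lemma hasDerivAt_erlangTail_succ (n : ℕ) (x : ℝ) :
    HasDerivAt (erlangTail (n + 1)) (-(Real.exp (-x) * (x ^ n / n.factorial))) x := by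
  have hexp : HasDerivAt (fun x : ℝ => Real.exp (-x)) (-Real.exp (-x)) x := by
    simpa using (hasDerivAt_neg x).exp
  induction n with
  | zero => simpa [funext (erlangTail_succ 0), erlangTail] using hexp
  | succ n ih =>
    rw [funext (erlangTail_succ (n + 1))]
    convert! ih.add (hexp.mul ((hasDerivAt_pow (n + 1) x).div_const _)) using 1
    have : (n.factorial : ℝ) ≠ 0 := by positivity
    rw [Nat.factorial_succ]
    push_cast
    field_simp
    simp

lemma tendsto_erlangTail_atTop (n : ℕ) : Tendsto (erlangTail n) atTop (𝓝 0) := by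
  induction n with
  | zero => simp [funext fun x => show erlangTail 0 x = 0 by simp [erlangTail]]
  | succ n ih =>
    have := ih.add ((Real.tendsto_pow_mul_exp_neg_atTop_nhds_zero n).div_const (n.factorial : ℝ))
    rw [zero_div, add_zero] at this
    refine this.congr fun x => ?_
    rw [erlangTail_succ]
    ring

lemma gammaMeasure_Ici_eq_erlangTail {n : ℕ} (hn : n ≠ 0) {r : ℝ} (hr : 0 < r) {c : ℝ}
    (hc : 0 ≤ c) : gammaMeasure n r (Ici c) = ENNReal.ofReal (erlangTail n (r * c)) := by
  obtain ⟨k, rfl⟩ := Nat.exists_eq_succ_of_ne_zero hn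
  set f : ℝ → ℝ := fun x => Real.exp (-(r * x)) * ((r * x) ^ k / k.factorial) * r
  have hpdf : EqOn (gammaPDF (k + 1 : ℕ) r) (fun x => ENNReal.ofReal (f x)) (Ioi c) := by
    intro x hx
    rw [gammaPDF_of_nonneg (hc.trans (le_of_lt hx))]
    push_cast
    rw [Real.Gamma_nat_eq_factorial, add_sub_cancel_right, Real.rpow_natCast,
      Real.rpow_add_one hr.ne', Real.rpow_natCast]
    simp only [f]
    ring_nf
  have hderiv (x : ℝ) : HasDerivAt (fun x => -erlangTail (k + 1) (r * x)) (f x) x := by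
    simpa [f] using ((hasDerivAt_erlangTail_succ k (r * x)).comp x
      ((hasDerivAt_id x).const_mul r)).fun_neg
  have hnn : ∀ x ∈ Ioi c, 0 ≤ f x := fun x hx => by
    have : 0 ≤ x := hc.trans (le_of_lt hx)
    positivity
  have hlim : Tendsto (fun x => -erlangTail (k + 1) (r * x)) atTop (𝓝 0) := by
    simpa using ((tendsto_erlangTail_atTop (k + 1)).comp (tendsto_id.const_mul_atTop hr)).neg
  have hint := integrableOn_Ioi_deriv_of_nonneg' (a := c) (fun x _ => hderiv x) hnn hlim
  rw [gammaMeasure, withDensity_apply _ measurableSet_Ici, setLIntegral_congr Ioi_ae_eq_Ici.symm,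
    setLIntegral_congr_fun measurableSet_Ioi hpdf, ← ofReal_integral_eq_lintegral_ofReal hint
      ((ae_restrict_iff' measurableSet_Ioi).2 (Eventually.of_forall hnn)),
    integral_Ioi_of_hasDerivAt_of_nonneg' (a := c) (fun x _ => hderiv x) hnn hlim]
  simp

lemma gammaMeasure_Iic_zero (a r : ℝ) : gammaMeasure a r (Iic 0) = 0 := by
  rw [gammaMeasure, withDensity_apply _ measurableSet_Iic, setLIntegral_congr Iio_ae_eq_Iic.symm]
  exact lintegral_gammaPDF_of_nonpos le_rfl

lemma gammaPDF_mul_exp_neg {a r t : ℝ} (ha : 0 < a) (hr : 0 < r) (ht : 0 ≤ t) (x : ℝ) :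
    gammaPDF a r x * ENNReal.ofReal (Real.exp (-(t * x)))
      = ENNReal.ofReal ((r / (r + t)) ^ a) * gammaPDF a (r + t) x := by
  rcases lt_or_ge x 0 with hx | hx
  · simp [gammaPDF_of_neg hx]
  have := Real.Gamma_pos_of_pos ha
  have hexp : Real.exp (-((r + t) * x)) = Real.exp (-(r * x)) * Real.exp (-(t * x)) := by
    rw [← Real.exp_add]; ring_nf
  rw [gammaPDF_of_nonneg hx, gammaPDF_of_nonneg hx, ← ENNReal.ofReal_mul (by positivity),
    ← ENNReal.ofReal_mul (by positivity), Real.div_rpow hr.le (by positivity), hexp]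
  congr 1
  have : (r + t) ^ a ≠ 0 := by positivity
  field_simp

lemma lintegral_expNeg_mul_gammaMeasure {a r t : ℝ} (ha : 0 < a) (hr : 0 < r) (ht : 0 ≤ t) :
    ∫⁻ x, expNeg (ENNReal.ofReal (t * x)) ∂gammaMeasure a r
      = ENNReal.ofReal ((r / (r + t)) ^ a) := by
  have hmeas (r : ℝ) : Measurable (gammaPDF a r) := (measurable_gammaPDFReal _ _).ennreal_ofReal
  have hpos (x : ℝ) : (gammaPDF a r * fun x => expNeg (ENNReal.ofReal (t * x))) x
      = ENNReal.ofReal ((r / (r + t)) ^ a) * gammaPDF a (r + t) x := by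
    rw [← gammaPDF_mul_exp_neg ha hr ht, Pi.mul_apply]
    rcases lt_or_ge x 0 with hx | hx
    · simp [gammaPDF_of_neg hx]
    · rw [expNeg_ofReal (by positivity)]
  rw [gammaMeasure, lintegral_withDensity_eq_lintegral_mul _ (hmeas r) (by fun_prop),
    lintegral_congr hpos, lintegral_const_mul _ (hmeas _),
    lintegral_gammaPDF_eq_one ha (by positivity), mul_one]

lemma gammaMeasure_setOf_one_le_div {n : ℕ} (hn : n ≠ 0) {a : ℝ} (ha : 0 < a) {I : ℝ≥0∞}
    (hI : I ≠ ∞) :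
    gammaMeasure n 1 {h | 1 ≤ ENNReal.ofReal (a * h) / I}
      = ENNReal.ofReal (erlangTail n (a⁻¹ * I.toReal)) := by
  rw [← one_mul (a⁻¹ * I.toReal), ← gammaMeasure_Ici_eq_erlangTail hn one_pos (by positivity)]
  refine measure_congr ?_
  filter_upwards [measure_eq_zero_iff_ae_notMem.1 (gammaMeasure_Iic_zero n 1)] with h hh
  have hah : 0 < a * h := mul_pos ha (notMem_Iic.1 hh)
  refine propext ?_
  change 1 ≤ ENNReal.ofReal (a * h) / I ↔ a⁻¹ * I.toReal ≤ h
  rw [inv_mul_le_iff₀ ha, ENNReal.le_div_iff_mul_le (Or.inr (by simpa using hah))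
    (Or.inl hI), one_mul, ENNReal.le_ofReal_iff_toReal_le hI hah.le]

/-! ### Finiteness and derivatives of Laplace transforms -/

section LaplaceTransform

variable {Ω : Type*} [MeasurableSpace Ω] {P : Measure Ω}

lemma Iio_zero_subset_interior_integrableExpSet [IsFiniteMeasure P] {X : Ω → ℝ}
    (hX : AEMeasurable X P) (hX0 : 0 ≤ᵐ[P] X) :
    Iio 0 ⊆ interior (integrableExpSet X P) := by
  refine interior_maximal (fun t ht => ?_) isOpen_Iio
  refine Integrable.mono' (integrable_const (1 : ℝ)) (by fun_prop) ?_
  filter_upwards [hX0] with ω hω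
  rw [Real.norm_of_nonneg (Real.exp_pos _).le, Real.exp_le_one_iff]
  exact mul_nonpos_of_nonpos_of_nonneg (le_of_lt ht) hω

/-- The random variable `Y` with values in `[0, ∞]` is almost surely finite and its Laplace
transform is `g` on the positive half-line. -/
structure HasLaplaceTransform (Y : Ω → ℝ≥0∞) (g : ℝ → ℝ) (P : Measure Ω) : Prop where
  aemeasurable : AEMeasurable Y P
  ae_lt_top : ∀ᵐ ω ∂P, Y ω < ∞
  integral_exp : ∀ s, 0 < s → ∫ ω, Real.exp (-s * (Y ω).toReal) ∂P = g s

namespace HasLaplaceTransform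

variable {Y : Ω → ℝ≥0∞} {g : ℝ → ℝ}

lemma of_lintegral_expNeg [IsProbabilityMeasure P] (hY : AEMeasurable Y P)
    (hg : ∀ s, 0 < s → ∫⁻ ω, expNeg (ENNReal.ofReal s * Y ω) ∂P = ENNReal.ofReal (g s))
    (hg0 : ∀ s, 0 < s → 0 ≤ g s) (hlim : Tendsto g (𝓝[>] 0) (𝓝 1)) :
    HasLaplaceTransform Y g P := by
  have hprob : P {ω | Y ω ≠ ∞} = 1 := by
    refine tendsto_nhds_unique (tendsto_lintegral_expNeg_mul hY) ?_
    rw [← ENNReal.ofReal_one]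
    refine (ENNReal.tendsto_ofReal hlim).congr' ?_
    filter_upwards [self_mem_nhdsWithin] with s hs using (hg s hs).symm
  have hfin : ∀ᵐ ω ∂P, Y ω ≠ ∞ :=
    (prob_compl_eq_zero_iff₀ (hY.nullMeasurable (measurableSet_singleton ∞).compl)).2 hprob
  refine ⟨hY, hfin.mono fun ω => lt_top_iff_ne_top.2, fun s hs => ?_⟩
  rw [integral_eq_lintegral_of_nonneg_ae (Eventually.of_forall fun ω => (Real.exp_pos _).le)
    (hY.ennreal_toReal.const_mul _).exp.aestronglyMeasurable,
    ← ENNReal.toReal_ofReal (hg0 s hs), ← hg s hs]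
  congr 1
  refine lintegral_congr_ae (hfin.mono fun ω hω => ?_)
  beta_reduce
  rw [expNeg_eq_ofReal (ENNReal.mul_ne_top ENNReal.ofReal_ne_top hω), ENNReal.toReal_mul,
    ENNReal.toReal_ofReal hs.le, neg_mul]

variable (h : HasLaplaceTransform Y g P)
include h

lemma mgf_neg {s : ℝ} (hs : 0 < s) : mgf (fun ω => (Y ω).toReal) P (-s) = g s :=
  h.integral_exp s hs

variable [IsFiniteMeasure P]

lemma neg_mem_interior_integrableExpSet {s : ℝ} (hs : 0 < s) :
    -s ∈ interior (integrableExpSet (fun ω => (Y ω).toReal) P) :=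
  Iio_zero_subset_interior_integrableExpSet h.aemeasurable.ennreal_toReal
    (Eventually.of_forall fun _ => ENNReal.toReal_nonneg) (neg_lt_zero.2 hs)

lemma contDiffOn {n : WithTop ℕ∞} : ContDiffOn ℝ n g (Ioi 0) := by
  have hmgf : AnalyticOn ℝ (fun s => mgf (fun ω => (Y ω).toReal) P (-s)) (Ioi 0) :=
    analyticOn_mgf.comp analyticOn_id.neg fun s hs => h.neg_mem_interior_integrableExpSet hs
  exact (hmgf.contDiffOn (uniqueDiffOn_Ioi 0)).congr fun s hs => (h.mgf_neg hs).symm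

lemma integrable_pow_mul_exp {s : ℝ} (hs : 0 < s) (m : ℕ) :
    Integrable (fun ω => (Y ω).toReal ^ m * Real.exp (-s * (Y ω).toReal)) P :=
  integrable_pow_mul_exp_of_mem_interior_integrableExpSet
    (h.neg_mem_interior_integrableExpSet hs) m

lemma integral_pow_mul_exp {s : ℝ} (hs : 0 < s) (m : ℕ) :
    ∫ ω, (Y ω).toReal ^ m * Real.exp (-s * (Y ω).toReal) ∂P
      = (-1) ^ m * iteratedDeriv m g s := by
  have hg : g =ᶠ[𝓝 s] fun t => mgf (fun ω => (Y ω).toReal) P (-t) :=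
    eventuallyEq_of_mem (Ioi_mem_nhds hs) fun t ht => (h.mgf_neg ht).symm
  rw [hg.iteratedDeriv_eq, iteratedDeriv_comp_neg,
    iteratedDeriv_mgf (h.neg_mem_interior_integrableExpSet hs), smul_eq_mul, ← mul_assoc,
    ← mul_pow, neg_one_mul, neg_neg, one_pow, one_mul]

theorem integral_erlangTail {s : ℝ} (hs : 0 < s) (n : ℕ) :
    ∫ ω, erlangTail n (s * (Y ω).toReal) ∂P
      = ∑ m ∈ Finset.range n, s ^ m / m.factorial * (-1) ^ m * iteratedDeriv m g s := by
  have hsum (y : ℝ) : erlangTail n (s * y)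
      = ∑ m ∈ Finset.range n, s ^ m / m.factorial * (y ^ m * Real.exp (-s * y)) := by
    rw [erlangTail, Finset.mul_sum]
    refine Finset.sum_congr rfl fun m _ => ?_
    rw [mul_pow, neg_mul]
    ring
  simp_rw [hsum]
  rw [integral_finsetSum _ fun m _ => (h.integrable_pow_mul_exp hs m).const_mul _]
  refine Finset.sum_congr rfl fun m _ => ?_
  rw [integral_const_mul, h.integral_pow_mul_exp hs, mul_assoc]

end HasLaplaceTransform

end LaplaceTransform

/-! ### Incomplete Euler integrals and the hypergeometric function -/

/-- The quotient `(b)ₙ / (c)ₙ` of Pochhammer symbols, the coefficient of `x ^ n` in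
`₂F₁(1, b; c; x)`. -/
noncomputable def pochhammerRatio (b c : ℝ) (n : ℕ) : ℝ :=
  (ascPochhammer ℝ n).eval b / (ascPochhammer ℝ n).eval c

lemma pochhammerRatio_zero (b c : ℝ) : pochhammerRatio b c 0 = 1 := by simp [pochhammerRatio]

lemma pochhammerRatio_succ (b c : ℝ) (n : ℕ) :
    pochhammerRatio b c (n + 1) = pochhammerRatio b c n * ((b + n) / (c + n)) := by
  simp only [pochhammerRatio, ascPochhammer_succ_eval, mul_div_mul_comm]

lemma pochhammerRatio_pos {b c : ℝ} (hb : 0 < b) (hc : 0 < c) (n : ℕ) :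
    0 < pochhammerRatio b c n :=
  div_pos (ascPochhammer_pos n b hb) (ascPochhammer_pos n c hc)

lemma pochhammerRatio_add_one_right {c : ℝ} (hc : 0 < c) (b : ℝ) (n : ℕ) :
    pochhammerRatio b (c + 1) n = pochhammerRatio b c n * (c / (c + n)) := by
  have hshift : c * (ascPochhammer ℝ n).eval (c + 1) = (ascPochhammer ℝ n).eval c * (c + n) := by
    rw [← ascPochhammer_succ_eval, ascPochhammer_succ_left]
    simp
  have hpos := ascPochhammer_pos n c hc
  have hpos' := ascPochhammer_pos n (c + 1) (by positivity)
  have : 0 < c + n := by positivity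
  rw [pochhammerRatio, pochhammerRatio]
  field_simp
  linear_combination -(ascPochhammer ℝ n).eval b * hshift

lemma hasSum_ordinaryHypergeometric_one {b c x : ℝ} (hb : 0 < b) (hc : 0 < c) (hx : |x| < 1) :
    HasSum (fun n => pochhammerRatio b c n * x ^ n) (ordinaryHypergeometric (1 : ℝ) b c x) := by
  have hradius : (ordinaryHypergeometricSeries ℝ 1 b c).radius = 1 :=
    ordinaryHypergeometricSeries_radius_eq_one ℝ 1 b c fun k => by
      have : (0 : ℝ) ≤ k := k.cast_nonneg
      exact ⟨by linarith, by linarith, by linarith⟩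
  have hmem : x ∈ Metric.eball (0 : ℝ) (ordinaryHypergeometricSeries ℝ 1 b c).radius := by
    rw [hradius, mem_eball_zero_iff, ← ofReal_norm, Real.norm_eq_abs]
    exact ENNReal.ofReal_lt_one.2 hx
  have hsum := (ordinaryHypergeometricSeries ℝ 1 b c).hasSum hmem
  simp only [ordinaryHypergeometricSeries_apply_eq, ascPochhammer_eval_one, smul_eq_mul] at hsum
  refine hsum.congr_fun fun n => ?_
  have : (n.factorial : ℝ) ≠ 0 := by positivity
  rw [pochhammerRatio, inv_mul_cancel₀ this, one_mul, div_eq_mul_inv]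

/-- The incomplete Euler integral `∫₀ᵀ t ^ (a - 1) (t + s) ^ (-b) dt`. -/
noncomputable def eulerIntegral (a b s T : ℝ) : ℝ :=
  ∫ t in 0..T, t ^ (a - 1) * (t + s) ^ (-b)

section EulerIntegral

variable {a b s T : ℝ}

lemma intervalIntegrable_eulerIntegral (ha : 0 < a) (b : ℝ) (hs : 0 < s) (hT : 0 ≤ T) :
    IntervalIntegrable (fun t => t ^ (a - 1) * (t + s) ^ (-b)) volume 0 T := by
  refine (intervalIntegral.intervalIntegrable_rpow' (by linarith)).mul_continuousOn ?_
  rw [uIcc_of_le hT]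
  exact ContinuousOn.rpow_const (by fun_prop) fun t ht => Or.inl (by linarith [ht.1])

lemma eulerIntegral_nonneg (hs : 0 < s) (hT : 0 ≤ T) : 0 ≤ eulerIntegral a b s T :=
  intervalIntegral.integral_nonneg hT fun t ht =>
    mul_nonneg (Real.rpow_nonneg ht.1 _) (Real.rpow_nonneg (by linarith [ht.1]) _)

lemma eulerIntegral_eq_add (ha : 0 < a) (b : ℝ) (hs : 0 < s) (hT : 0 ≤ T) :
    eulerIntegral a b s T
      = T ^ a / a * (T + s) ^ (-b) + b / a * eulerIntegral (a + 1) (b + 1) s T := by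
  have hint := intervalIntegrable_eulerIntegral ha b hs hT
  have hint' := (intervalIntegrable_eulerIntegral (a := a + 1) (by linarith) (b + 1) hs
    hT).const_mul (b / a)
  have hcont : ContinuousOn (fun t => t ^ a / a * (t + s) ^ (-b)) (Icc 0 T) :=
    ((continuousOn_id.rpow_const fun t _ => Or.inr ha.le).div_const _).mul
      (ContinuousOn.rpow_const (by fun_prop) fun t ht => Or.inl (by linarith [ht.1]))
  have hderiv (t : ℝ) (ht : t ∈ Ioo 0 T) : HasDerivAt (fun t => t ^ a / a * (t + s) ^ (-b))
      (t ^ (a - 1) * (t + s) ^ (-b) -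
        b / a * (t ^ (a + 1 - 1) * (t + s) ^ (-(b + 1)))) t := by
    have hts : 0 < t + s := add_pos ht.1 hs
    convert! ((Real.hasDerivAt_rpow_const (p := a) (Or.inl ht.1.ne')).div_const a).mul
      (((hasDerivAt_id t).add_const s).rpow_const (p := -b) (Or.inl hts.ne')) using 1
    rw [add_sub_cancel_right, neg_add, ← sub_eq_add_neg]
    simp only [id_eq]
    field_simp
    ring
  have hftc := intervalIntegral.integral_eq_sub_of_hasDerivAt_of_le hT hcont hderiv
    (hint.sub hint')
  rw [intervalIntegral.integral_sub hint hint', intervalIntegral.integral_const_mul,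
    Real.zero_rpow ha.ne', zero_div, zero_mul, sub_zero, sub_eq_iff_eq_add] at hftc
  exact hftc

lemma eulerIntegral_add_natCast_le (ha : 0 < a) (b : ℝ) (hs : 0 < s) (hT : 0 ≤ T) (n : ℕ) :
    eulerIntegral (a + n) (b + n) s T ≤ (T / (T + s)) ^ n * eulerIntegral a b s T := by
  rw [eulerIntegral, eulerIntegral, ← intervalIntegral.integral_const_mul]
  refine intervalIntegral.integral_mono_on_of_le_Ioo hT
    (intervalIntegrable_eulerIntegral (by positivity) _ hs hT)
    ((intervalIntegrable_eulerIntegral ha b hs hT).const_mul _) fun t ht => ?_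
  have h0 : 0 < t := ht.1
  have hts : 0 < t + s := add_pos h0 hs
  have hratio : t / (t + s) ≤ T / (T + s) := by
    rw [div_le_div_iff₀ hts (by linarith)]
    nlinarith [ht.2]
  calc t ^ (a + n - 1) * (t + s) ^ (-(b + n))
      = (t / (t + s)) ^ n * (t ^ (a - 1) * (t + s) ^ (-b)) := by
        rw [add_sub_right_comm, Real.rpow_add h0, neg_add, Real.rpow_add hts,
          Real.rpow_neg hts.le n, Real.rpow_natCast, Real.rpow_natCast, div_pow]
        ring
    _ ≤ _ := by gcongr

lemma eulerIntegral_eq_sum_add (ha : 0 < a) (b : ℝ) (hs : 0 < s) (hT : 0 < T) (n : ℕ) :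
    eulerIntegral a b s T
      = ∑ k ∈ Finset.range n, T ^ a / a * (T + s) ^ (-b) *
          (pochhammerRatio b (a + 1) k * (T / (T + s)) ^ k)
        + pochhammerRatio b a n * eulerIntegral (a + n) (b + n) s T := by
  induction n with
  | zero => simp [pochhammerRatio_zero]
  | succ n ih =>
    have hTs : 0 < T + s := by positivity
    have hrec := eulerIntegral_eq_add (a := a + n) (by positivity) (b + n) hs hT.le
    have hpow : T ^ (a + n) / (a + n) * (T + s) ^ (-(b + n))
        = T ^ a * (T + s) ^ (-b) * (T / (T + s)) ^ n / (a + n) := by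
      rw [Real.rpow_add hT, neg_add, Real.rpow_add hTs, Real.rpow_neg hTs.le n,
        Real.rpow_natCast, Real.rpow_natCast, div_pow]
      field_simp
    rw [Finset.sum_range_succ, ih, hrec, hpow, pochhammerRatio_succ,
      pochhammerRatio_add_one_right ha]
    push_cast
    rw [← add_assoc a, ← add_assoc b]
    field_simp
    ring

theorem eulerIntegral_eq_ordinaryHypergeometric (ha : 0 < a) (hb : 0 < b) (hs : 0 < s)
    (hT : 0 < T) :
    eulerIntegral a b s T
      = T ^ a / a * (T + s) ^ (-b) * ordinaryHypergeometric (1 : ℝ) b (a + 1) (T / (T + s)) := by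
  set x := T / (T + s) with hx
  have hx1 : |x| < 1 := by
    rw [abs_of_pos (by positivity), hx, div_lt_one (by positivity)]
    linarith
  have hremainder : Tendsto (fun n : ℕ => pochhammerRatio b a n * eulerIntegral (a + n) (b + n) s T)
      atTop (𝓝 0) := by
    have hzero := (hasSum_ordinaryHypergeometric_one hb ha
      hx1).summable.tendsto_atTop_zero.mul_const (eulerIntegral a b s T)
    rw [zero_mul] at hzero
    refine squeeze_zero (fun n => mul_nonneg (pochhammerRatio_pos hb ha n).le
      (eulerIntegral_nonneg hs hT.le)) (fun n => ?_) hzero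
    rw [mul_assoc]
    exact mul_le_mul_of_nonneg_left (eulerIntegral_add_natCast_le ha b hs hT.le n)
      (pochhammerRatio_pos hb ha n).le
  have hseries := ((hasSum_ordinaryHypergeometric_one hb (by positivity : 0 < a + 1)
    hx1).mul_left (T ^ a / a * (T + s) ^ (-b))).tendsto_sum_nat
  simpa using tendsto_nhds_unique
    (tendsto_const_nhds.congr (eulerIntegral_eq_sum_add ha b hs hT)) (hseries.add hremainder)

lemma eulerIntegral_inv_inv (ha : 0 < a) (hb : 0 < b) (hs : 0 < s) (hT : 0 < T) :
    eulerIntegral a b s⁻¹ T⁻¹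
      = s ^ b * T ^ (b - a) / (a * (s + T) ^ b) *
          ordinaryHypergeometric (1 : ℝ) b (a + 1) (s / (s + T)) := by
  have hadd : T⁻¹ + s⁻¹ = (s + T) / (s * T) := by field_simp
  have hratio : T⁻¹ / (T⁻¹ + s⁻¹) = s / (s + T) := by field_simp
  rw [eulerIntegral_eq_ordinaryHypergeometric ha hb (by positivity) (by positivity), hratio, hadd,
    Real.inv_rpow hT.le, Real.rpow_neg (by positivity), Real.div_rpow (by positivity)
    (by positivity), Real.mul_rpow hs.le hT.le, Real.rpow_sub hT]
  field_simp

end EulerIntegral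

lemma one_sub_inv_one_add_pow {x : ℝ} (hx : 0 ≤ x) (N : ℕ) :
    1 - ((1 + x) ^ N)⁻¹ = ∑ m ∈ Finset.range N, x * ((1 + x) ^ (m + 1))⁻¹ := by
  induction N with
  | zero => simp
  | succ N ih =>
    rw [Finset.sum_range_succ, ← ih, pow_succ]
    field_simp
    ring

/-- The series of hypergeometric values that a disc of radius `D` contributes to the Laplace
exponent, at `δ = 2 / α` and with `T` in place of `D ^ α`. -/
noncomputable def nearSeries (δ : ℝ) (N : ℕ) (T s : ℝ) : ℝ :=
  ∑ m ∈ Finset.range N, T ^ ((m : ℝ) + δ) / (((m : ℝ) + δ) * (s + T) ^ (m + 1)) *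
    ordinaryHypergeometric (1 : ℝ) ((m : ℝ) + 1) ((m : ℝ) + δ + 1) (T / (T + s))

/-- The series of hypergeometric values that the complement of a disc contributes to the Laplace
exponent, in the same parameters as `nearSeries`. -/
noncomputable def farSeries (δ : ℝ) (N : ℕ) (T s : ℝ) : ℝ :=
  ∑ m ∈ Finset.range N, T ^ ((m : ℝ) + δ) / ((1 - δ) * (s + T) ^ (m + 1)) *
    ordinaryHypergeometric (1 : ℝ) ((m : ℝ) + 1) (2 - δ) (s / (s + T))

section RadialIntegral

variable {δ s T : ℝ}

lemma setIntegral_eq_sum_eulerIntegral {N : ℕ} {F : ℝ → ℝ} {a b c : ℕ → ℝ}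
    (ha : ∀ m, 0 < a m) (hs : 0 < s) (hT : 0 ≤ T)
    (hF : ∀ y ∈ Ioc 0 T, F y
      = ∑ m ∈ Finset.range N, c m * (y ^ (a m - 1) * (y + s) ^ (-b m))) :
    IntegrableOn F (Ioc 0 T) ∧
      ∫ y in Ioc 0 T, F y = ∑ m ∈ Finset.range N, c m * eulerIntegral (a m) (b m) s T := by
  have hint (m : ℕ) : IntegrableOn (fun y => c m * (y ^ (a m - 1) * (y + s) ^ (-b m))) (Ioc 0 T) :=
    (intervalIntegrable_iff_integrableOn_Ioc_of_le hT).1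
      ((intervalIntegrable_eulerIntegral (ha m) (b m) hs hT).const_mul (c m))
  refine ⟨(integrableOn_congr_fun hF measurableSet_Ioc).2
    (integrable_finsetSum _ fun m _ => hint m), ?_⟩
  rw [setIntegral_congr_fun measurableSet_Ioc hF, integral_finsetSum _ fun m _ => hint m]
  refine Finset.sum_congr rfl fun m _ => ?_
  rw [integral_const_mul, eulerIntegral, intervalIntegral.integral_of_le hT]

lemma integral_rpow_mul_one_sub_inv_div_eq_nearSeries (hδ : 0 < δ) (hs : 0 < s) (hT : 0 < T)
    (N : ℕ) :
    IntegrableOn (fun y => y ^ (δ - 1) * (1 - ((1 + s * y⁻¹) ^ N)⁻¹)) (Ioc 0 T) ∧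
      ∫ y in Ioc 0 T, y ^ (δ - 1) * (1 - ((1 + s * y⁻¹) ^ N)⁻¹) = s * nearSeries δ N T s := by
  obtain ⟨hint, heq⟩ := setIntegral_eq_sum_eulerIntegral (N := N) (s := s) (T := T)
    (a := fun m => m + δ) (b := fun m => m + 1) (c := fun _ => s)
    (F := fun y => y ^ (δ - 1) * (1 - ((1 + s * y⁻¹) ^ N)⁻¹)) (fun m => by positivity) hs hT.le
    fun y hy => by
      have hy0 : 0 < y := hy.1
      rw [one_sub_inv_one_add_pow (by positivity), Finset.mul_sum]
      refine Finset.sum_congr rfl fun m _ => ?_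
      have hadd : 1 + s * y⁻¹ = (y + s) / y := by field_simp
      rw [hadd, div_pow, add_sub_assoc, Real.rpow_add hy0, Real.rpow_natCast,
        ← Nat.cast_add_one, Real.rpow_neg (by positivity), Real.rpow_natCast]
      field_simp
      ring
  refine ⟨hint, heq.trans ?_⟩
  rw [nearSeries, Finset.mul_sum]
  refine Finset.sum_congr rfl fun m _ => ?_
  rw [eulerIntegral_eq_ordinaryHypergeometric (by positivity) (by positivity) hs hT, add_comm T s,
    Real.rpow_neg (by positivity), ← Nat.cast_add_one, Real.rpow_natCast]
  field_simp

lemma integral_rpow_mul_one_sub_inv_mul_eq_farSeries (hδ : δ < 1) (hs : 0 < s) (hT : 0 < T)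
    (N : ℕ) :
    IntegrableOn (fun y => y ^ (-δ - 1) * (1 - ((1 + s * y) ^ N)⁻¹)) (Ioc 0 T⁻¹) ∧
      ∫ y in Ioc 0 T⁻¹, y ^ (-δ - 1) * (1 - ((1 + s * y) ^ N)⁻¹) = s * farSeries δ N T s := by
  obtain ⟨hint, heq⟩ := setIntegral_eq_sum_eulerIntegral (N := N) (s := s⁻¹) (T := T⁻¹)
    (a := fun _ => 1 - δ) (b := fun m => m + 1) (c := fun m => s * (s ^ (m + 1))⁻¹)
    (F := fun y => y ^ (-δ - 1) * (1 - ((1 + s * y) ^ N)⁻¹)) (fun _ => by linarith)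
    (by positivity) (by positivity) fun y hy => by
      have hy0 : 0 < y := hy.1
      rw [one_sub_inv_one_add_pow (by positivity), Finset.mul_sum]
      refine Finset.sum_congr rfl fun m _ => ?_
      have hadd : 1 + s * y = s * (y + s⁻¹) := by field_simp; ring
      have hpow : y ^ (1 - δ - 1) = y ^ (-δ - 1) * y := by
        rw [← Real.rpow_add_one hy0.ne']
        ring_nf
      rw [hadd, hpow, mul_pow, ← Nat.cast_add_one, Real.rpow_neg (by positivity),
        Real.rpow_natCast]
      field_simp
  refine ⟨hint, heq.trans ?_⟩
  rw [farSeries, Finset.mul_sum]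
  refine Finset.sum_congr rfl fun m _ => ?_
  have hexp : (m : ℝ) + 1 - (1 - δ) = m + δ := by ring
  have hparam : 1 - δ + 1 = 2 - δ := by ring
  rw [eulerIntegral_inv_inv (by linarith) (by positivity) hs hT, hexp, hparam, ← Nat.cast_add_one,
    Real.rpow_natCast, Real.rpow_natCast]
  field_simp

lemma eqOn_mul_comp_rpow_div {p w : ℝ} (hp : p ≠ 0) (hw : 0 < w) (G : ℝ → ℝ) :
    EqOn (fun r => r * G (r ^ p / w))
      (fun r => (w ^ (2 / p - 1) * |p|⁻¹) *
          ((|p| * r ^ (p - 1)) • ((w⁻¹ * r ^ p) ^ (2 / p - 1) * G (w⁻¹ * r ^ p)))) (Ioi 0) := by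
  intro r hr
  have hr : 0 < r := hr
  have hpow : r ^ (p - 1) * (r ^ p) ^ (2 / p - 1) = r := by
    rw [← Real.rpow_mul hr.le, ← Real.rpow_add hr]
    have : p - 1 + p * (2 / p - 1) = 1 := by field_simp; ring
    rw [this, Real.rpow_one]
  have hscale : w ^ (2 / p - 1) * (w⁻¹ * r ^ p) ^ (2 / p - 1) = (r ^ p) ^ (2 / p - 1) := by
    rw [← Real.mul_rpow hw.le (by positivity), mul_inv_cancel_left₀ hw.ne']
  have hp' : |p|⁻¹ * |p| = 1 := inv_mul_cancel₀ (abs_ne_zero.2 hp)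
  simp only [smul_eq_mul, div_eq_inv_mul _ w]
  calc r * G (w⁻¹ * r ^ p)
      = (|p|⁻¹ * |p|) * (r ^ (p - 1) * (w ^ (2 / p - 1) * (w⁻¹ * r ^ p) ^ (2 / p - 1))) *
          G (w⁻¹ * r ^ p) := by rw [hscale, hpow, hp', one_mul]
    _ = _ := by ring

lemma integrableOn_mul_comp_rpow_div_iff {p w : ℝ} (hp : p ≠ 0) (hw : 0 < w) (G : ℝ → ℝ) :
    IntegrableOn (fun r => r * G (r ^ p / w)) (Ioi 0) ↔
      IntegrableOn (fun y => y ^ (2 / p - 1) * G y) (Ioi 0) := by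
  have hunit : IsUnit (w ^ (2 / p - 1) * |p|⁻¹) :=
    (mul_pos (Real.rpow_pos_of_pos hw _) (by positivity)).ne'.isUnit
  rw [integrableOn_congr_fun (eqOn_mul_comp_rpow_div hp hw G) measurableSet_Ioi,
    IntegrableOn, integrable_const_mul_iff hunit, ← IntegrableOn,
    integrableOn_Ioi_comp_rpow_iff (fun y => (w⁻¹ * y) ^ (2 / p - 1) * G (w⁻¹ * y)) hp,
    integrableOn_Ioi_comp_mul_left_iff (fun y => y ^ (2 / p - 1) * G y) 0 (inv_pos.2 hw), mul_zero]

lemma integral_mul_comp_rpow_div {p w : ℝ} (hp : p ≠ 0) (hw : 0 < w) (G : ℝ → ℝ) :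
    ∫ r in Ioi 0, r * G (r ^ p / w)
      = w ^ (2 / p) * |p|⁻¹ * ∫ y in Ioi 0, y ^ (2 / p - 1) * G y := by
  rw [setIntegral_congr_fun measurableSet_Ioi (eqOn_mul_comp_rpow_div hp hw G),
    integral_const_mul,
    integral_comp_rpow_Ioi (fun y => (w⁻¹ * y) ^ (2 / p - 1) * G (w⁻¹ * y)) hp,
    integral_comp_mul_left_Ioi (fun y => y ^ (2 / p - 1) * G y) 0 (inv_pos.2 hw), mul_zero,
    Real.rpow_sub_one hw.ne', smul_eq_mul, inv_inv]
  field_simp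

lemma setIntegral_mul_comp_rpow_div {p w B : ℝ} {F : ℝ → ℝ} (hp : p ≠ 0) (hw : 0 < w)
    (hF : IntegrableOn (fun y => y ^ (2 / p - 1) * F y) (Ioc 0 B)) :
    IntegrableOn (fun r => r * F (r ^ p / w)) (Ioi 0 ∩ {r | r ^ p / w ≤ B}) ∧
      ∫ r in Ioi 0 ∩ {r | r ^ p / w ≤ B}, r * F (r ^ p / w)
        = w ^ (2 / p) * |p|⁻¹ * ∫ y in Ioc 0 B, y ^ (2 / p - 1) * F y := by
  have hmeas : MeasurableSet {r : ℝ | r ^ p / w ≤ B} :=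
    measurableSet_le (by fun_prop) measurable_const
  have hleft : (fun r => r * (Iic B).indicator F (r ^ p / w))
      = {r | r ^ p / w ≤ B}.indicator fun r => r * F (r ^ p / w) := by
    ext r
    simp only [indicator_apply, mem_Iic, mem_ofPred_eq, mul_ite, mul_zero]
  have hright : (fun y => y ^ (2 / p - 1) * (Iic B).indicator F y)
      = (Iic B).indicator fun y => y ^ (2 / p - 1) * F y := by
    ext y
    simp only [indicator_apply, mul_ite, mul_zero]
  constructor
  · have hiff := integrableOn_mul_comp_rpow_div_iff hp hw ((Iic B).indicator F)
    rw [hleft, hright, integrableOn_indicator_iff hmeas,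
      integrableOn_indicator_iff measurableSet_Iic, inter_comm, inter_comm (Iic B),
      Ioi_inter_Iic] at hiff
    exact hiff.2 hF
  · have heq := integral_mul_comp_rpow_div hp hw ((Iic B).indicator F)
    rwa [hleft, hright, setIntegral_indicator hmeas, setIntegral_indicator measurableSet_Iic,
      Ioi_inter_Iic] at heq

variable {α w D : ℝ}

lemma integral_Ioc_mul_one_sub_inv (hα : 0 < α) (hw : 0 < w) (hs : 0 < s) (hD : 0 < D) (N : ℕ) :
    IntegrableOn (fun r => r * (1 - ((1 + s * (w * r ^ (-α))) ^ N)⁻¹)) (Ioc 0 D) ∧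
      ∫ r in Ioc 0 D, r * (1 - ((1 + s * (w * r ^ (-α))) ^ N)⁻¹)
        = w ^ (2 / α) / α * (s * nearSeries (2 / α) N (D ^ α / w) s) := by
  have hset : Ioi 0 ∩ {r : ℝ | r ^ α / w ≤ D ^ α / w} = Ioc 0 D := by
    ext r
    refine and_congr_right fun hr => ?_
    rw [mem_ofPred_eq, div_le_div_iff_of_pos_right hw, Real.rpow_le_rpow_iff (le_of_lt hr) hD.le hα]
  have hfun : EqOn (fun r => r * (1 - ((1 + s * (w * r ^ (-α))) ^ N)⁻¹))
      (fun r => r * (1 - ((1 + s * (r ^ α / w)⁻¹) ^ N)⁻¹)) (Ioc 0 D) := fun r hr => by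
    simp only [Real.rpow_neg hr.1.le, inv_div, div_eq_mul_inv w]
  obtain ⟨hint, heq⟩ := integral_rpow_mul_one_sub_inv_div_eq_nearSeries (δ := 2 / α)
    (by positivity) hs (T := D ^ α / w) (by positivity) N
  obtain ⟨hint', heq'⟩ := setIntegral_mul_comp_rpow_div hα.ne' hw hint
  rw [hset] at hint' heq'
  refine ⟨(integrableOn_congr_fun hfun measurableSet_Ioc).2 hint', ?_⟩
  rw [setIntegral_congr_fun measurableSet_Ioc hfun, heq', heq, abs_of_pos hα,
    div_eq_mul_inv (w ^ _)]

lemma integral_Ioi_mul_one_sub_inv (hα : 2 < α) (hw : 0 < w) (hs : 0 < s) (hD : 0 < D) (N : ℕ) :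
    IntegrableOn (fun r => r * (1 - ((1 + s * (w * r ^ (-α))) ^ N)⁻¹)) (Ioi D) ∧
      ∫ r in Ioi D, r * (1 - ((1 + s * (w * r ^ (-α))) ^ N)⁻¹)
        = w ^ (2 / α) / α * (s * farSeries (2 / α) N (D ^ α / w) s) := by
  have hα0 : 0 < α := by linarith
  have hset : Ioi 0 ∩ {r : ℝ | r ^ (-α) / w⁻¹ ≤ (D ^ α / w)⁻¹} = Ici D := by
    ext r
    have hinv : (D ^ α / w)⁻¹ = D ^ (-α) / w⁻¹ := by
      rw [Real.rpow_neg hD.le, div_inv_eq_mul, inv_div, div_eq_inv_mul]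
    rw [mem_inter_iff, mem_ofPred_eq, hinv, div_le_div_iff_of_pos_right (inv_pos.2 hw)]
    exact ⟨fun h => (Real.rpow_le_rpow_iff_of_neg h.1 hD (by linarith)).1 h.2, fun h =>
      ⟨hD.trans_le h, (Real.rpow_le_rpow_iff_of_neg (hD.trans_le h) hD (by linarith)).2 h⟩⟩
  obtain ⟨hint, heq⟩ := integral_rpow_mul_one_sub_inv_mul_eq_farSeries (δ := 2 / α)
    ((div_lt_one hα0).2 hα) hs (T := D ^ α / w) (by positivity) N
  rw [← div_neg] at hint heq
  obtain ⟨hint', heq'⟩ := setIntegral_mul_comp_rpow_div (neg_ne_zero.2 hα0.ne') (inv_pos.2 hw) hint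
  rw [hset] at hint' heq'
  simp only [div_inv_eq_mul, mul_comm _ w] at hint' heq'
  refine ⟨hint'.mono_set Ioi_subset_Ici_self, ?_⟩
  rw [setIntegral_congr_set Ioi_ae_eq_Ici, heq', heq, abs_neg, abs_of_pos hα0, div_neg,
    Real.rpow_neg (by positivity), Real.inv_rpow hw.le, inv_inv, div_eq_mul_inv (w ^ _)]

end RadialIntegral

/-! ### Product and conditional measures -/

lemma lintegral_ite_of_measure_eq_ofReal {α : Type*} [MeasurableSpace α] {μ : Measure α}
    [IsProbabilityMeasure μ] {P : α → Prop} [DecidablePred P] (hP : MeasurableSet {x | P x})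
    {q : ℝ} (hq : 0 ≤ q) (hμ : μ {x | P x} = ENNReal.ofReal q) (a b : ℝ≥0∞) :
    ∫⁻ x, (if P x then a else b) ∂μ = ENNReal.ofReal q * a + ENNReal.ofReal (1 - q) * b := by
  have hpiecewise := lintegral_piecewise (μ := μ) hP (fun _ => a) fun _ => b
  rw [lintegral_const, lintegral_const, Measure.restrict_apply_univ, Measure.restrict_apply_univ,
    prob_compl_eq_one_sub hP, hμ] at hpiecewise
  rw [ENNReal.ofReal_sub _ hq, ENNReal.ofReal_one, mul_comm, mul_comm (_ - _)]
  exact hpiecewise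

lemma measurePreserving_arrowProdEquivProdArrow_infinitePi {ι α β : Type*} [MeasurableSpace α]
    [MeasurableSpace β] (κ : ι → Measure α) (γ : ι → Measure β)
    [∀ i, IsProbabilityMeasure (κ i)] [∀ i, IsProbabilityMeasure (γ i)] :
    MeasurePreserving (MeasurableEquiv.arrowProdEquivProdArrow α β ι)
      (Measure.infinitePi fun i => (κ i).prod (γ i))
      ((Measure.infinitePi κ).prod (Measure.infinitePi γ)) := by
  set e := MeasurableEquiv.arrowProdEquivProdArrow α β ι
  suffices h : MeasurePreserving e.symm ((Measure.infinitePi κ).prod (Measure.infinitePi γ))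
      (Measure.infinitePi fun i => (κ i).prod (γ i)) from h.symm
  refine ⟨e.symm.measurable, Measure.eq_infinitePi _ fun s t ht => ?_⟩
  have hst : MeasurableSet ((s : Set ι).pi t) := .pi s.countable_toSet fun i _ => ht i
  have hsection (i : ι) : Measurable fun x => γ i (Prod.mk x ⁻¹' t i) :=
    measurable_measure_prodMk_left (ht i)
  have hfiber (a : ι → α) : Measure.infinitePi γ (Prod.mk a ⁻¹' (e.symm ⁻¹' (s : Set ι).pi t))
      = ∏ i ∈ s, γ i (Prod.mk (a i) ⁻¹' t i) := by
    rw [← Measure.infinitePi_pi γ fun i _ => measurable_prodMk_left (ht i)]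
    rfl
  rw [Measure.map_apply e.symm.measurable hst, Measure.prod_apply (e.symm.measurable hst)]
  simp_rw [hfiber]
  rw [lintegral_prod_eq_prod_lintegral_of_indepFun s
    (fun i (a : ι → α) => γ i (Prod.mk (a i) ⁻¹' t i)) (iIndepFun_infinitePi hsection)
    fun i => (hsection i).comp (measurable_pi_apply i)]
  refine Finset.prod_congr rfl fun i _ => ?_
  rw [Measure.prod_apply (ht i)]
  exact (measurePreserving_eval_infinitePi κ i).lintegral_comp (hsection i)

lemma measurePreserving_prod_rearrange {α β γ δ ε : Type*} [MeasurableSpace α]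
    [MeasurableSpace β] [MeasurableSpace γ] [MeasurableSpace δ] [MeasurableSpace ε]
    (μ₁ : Measure α) (μ₂ : Measure β) (μ₃ : Measure γ) (μ₄ : Measure δ) (μ₅ : Measure ε)
    [SFinite μ₁] [SFinite μ₂] [SFinite μ₃] [SFinite μ₄] [SFinite μ₅] :
    MeasurePreserving
      (fun x : α × β × (γ × δ) × ε => ((x.1, x.2.2.1.1), ((x.2.1, x.2.2.2), x.2.2.1.2)))
      (μ₁.prod (μ₂.prod ((μ₃.prod μ₄).prod μ₅))) ((μ₁.prod μ₃).prod ((μ₂.prod μ₅).prod μ₄)) := by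
  refine ⟨by fun_prop, Measure.ext_of_lintegral _ fun f hf => ?_⟩
  calc ∫⁻ y, f y ∂_
      = ∫⁻ a, ∫⁻ b, ∫⁻ c, ∫⁻ d, ∫⁻ e, f ((a, c), ((b, e), d)) ∂μ₅ ∂μ₄ ∂μ₃ ∂μ₂ ∂μ₁ := by
        rw [lintegral_map hf (by fun_prop), lintegral_prod _ (by fun_prop)]
        refine lintegral_congr fun a => ?_
        rw [lintegral_prod _ (by fun_prop)]
        refine lintegral_congr fun b => ?_
        rw [lintegral_prod _ (by fun_prop), lintegral_prod _ (by fun_prop)]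
    _ = ∫⁻ a, ∫⁻ c, ∫⁻ b, ∫⁻ e, ∫⁻ d, f ((a, c), ((b, e), d)) ∂μ₄ ∂μ₅ ∂μ₂ ∂μ₃ ∂μ₁ := by
        refine lintegral_congr fun a => ?_
        rw [lintegral_lintegral_swap (by fun_prop)]
        refine lintegral_congr fun c => lintegral_congr fun b => ?_
        rw [lintegral_lintegral_swap (by fun_prop)]
    _ = ∫⁻ y, f y ∂((μ₁.prod μ₃).prod ((μ₂.prod μ₅).prod μ₄)) := by
        rw [lintegral_prod _ (by fun_prop), lintegral_prod _ (by fun_prop)]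
        refine lintegral_congr fun a => lintegral_congr fun c => ?_
        rw [lintegral_prod _ (by fun_prop), lintegral_prod _ (by fun_prop)]

lemma measurable_nat_sInf : Measurable (sInf : Set ℕ → ℕ) := by
  have hpreimage (n : ℕ) :
      sInf ⁻¹' Iic n = {s : Set ℕ | (∃ i, i ∈ s ∧ i ≤ n) ∨ ∀ i, i ∉ s} := by
    ext s
    simp only [mem_preimage, mem_Iic, mem_ofPred_eq, ← eq_empty_iff_forall_notMem]
    refine ⟨fun h => s.eq_empty_or_nonempty.symm.imp_left fun hs => ⟨_, Nat.sInf_mem hs, h⟩, ?_⟩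
    rintro (⟨i, hi, hin⟩ | rfl)
    exacts [(Nat.sInf_le hi).trans hin, Nat.sInf_empty.trans_le n.zero_le]
  refine measurable_of_Iic fun n => ?_
  rw [hpreimage]
  exact Measurable.setOf (by fun_prop)

lemma measureReal_mul_integral_cond {Ω : Type*} [MeasurableSpace Ω] (P : Measure Ω)
    [IsFiniteMeasure P] (A : Set Ω) (f : Ω → ℝ) :
    P.real A * ∫ ω, f ω ∂(ProbabilityTheory.cond P A) = ∫ ω in A, f ω ∂P := by
  rw [ProbabilityTheory.cond, integral_smul_measure, ENNReal.toReal_inv, smul_eq_mul, ← mul_assoc]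
  obtain h | h := eq_or_ne (P.real A) 0
  · rw [setIntegral_measure_zero _ ((measureReal_eq_zero_iff).1 h), mul_zero]
  · rw [← Measure.real, mul_inv_cancel₀ h, one_mul]

/-! ### The Laplace functional of a Poisson point process -/

lemma lintegral_expNeg_poissonMeasure (r : ℝ≥0) (c : ℝ≥0∞) :
    ∫⁻ n : ℕ, expNeg (c * n) ∂poissonMeasure r = expNeg (r * (1 - expNeg c)) := by
  obtain ⟨y, hy⟩ : ∃ y : ℝ≥0, expNeg c = y :=
    ⟨_, (ENNReal.coe_toNNReal ((expNeg_le_one c).trans_lt ENNReal.one_lt_top).ne).symm⟩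
  have hy1 : y ≤ 1 := by simpa [hy] using expNeg_le_one c
  have hsum : HasSum (fun n : ℕ => Real.exp (-r) * r ^ n / n.factorial * y ^ n)
      (Real.exp (-(r * (1 - y)))) := by
    have := (NormedSpace.expSeries_div_hasSum_exp (r * y : ℝ)).mul_left (Real.exp (-r))
    rw [← Real.exp_eq_exp_ℝ, ← Real.exp_add] at this
    rw [show -(r * (1 - y) : ℝ) = -r + r * y by ring]
    convert! this using 2
    ring
  calc ∫⁻ n : ℕ, expNeg (c * n) ∂poissonMeasure r
      = ∑' n : ℕ, ENNReal.ofReal (Real.exp (-r) * r ^ n / n.factorial * y ^ n) := by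
        simp only [expNeg_mul_natCast, hy, poissonMeasure, lintegral_sum_measure,
          lintegral_smul_measure, lintegral_dirac, smul_eq_mul]
        refine tsum_congr fun n => ?_
        rw [ENNReal.ofReal_mul (by positivity), ENNReal.ofReal_pow y.coe_nonneg,
          ENNReal.ofReal_coe_nnreal]
    _ = ENNReal.ofReal (Real.exp (-(r * (1 - y)))) := by
        rw [← ENNReal.ofReal_tsum_of_nonneg (fun n => by positivity) hsum.summable, hsum.tsum_eq]
    _ = expNeg (r * (1 - expNeg c)) := by
        rw [hy, ← expNeg_ofReal (mul_nonneg r.coe_nonneg (sub_nonneg.2 (by exact_mod_cast hy1)))]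
        congr 1
        rw [ENNReal.ofReal_mul r.coe_nonneg, ENNReal.ofReal_sub _ y.coe_nonneg]
        simp

lemma exists_monotone_finMeasSupp_tendsto {α : Type*} [MeasurableSpace α] (μ : Measure α)
    [SigmaFinite μ] {f : α → ℝ≥0∞} (hf : Measurable f) :
    ∃ g : ℕ → SimpleFunc α ℝ≥0∞, (∀ k, (g k).FinMeasSupp μ) ∧ Monotone g ∧
      ∀ x, Tendsto (fun k => g k x) atTop (𝓝 (f x)) := by
  have happ (k : ℕ) (x : α) : ((SimpleFunc.eapprox f k).restrict (spanningSets μ k)) x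
      = (spanningSets μ k).indicator (SimpleFunc.eapprox f k) x :=
    SimpleFunc.restrict_apply _ (measurableSet_spanningSets μ k) x
  refine ⟨fun k => (SimpleFunc.eapprox f k).restrict (spanningSets μ k), fun k => ?_,
    fun k l hkl x => ?_, fun x => ?_⟩
  · refine SimpleFunc.finMeasSupp_iff_support.2
      ((measure_mono fun x hx => ?_).trans_lt (measure_spanningSets_lt_top μ k))
    by_contra hn
    simp [happ, hn] at hx
  · rw [happ, happ]
    exact (indicator_le_indicator (SimpleFunc.monotone_eapprox f hkl x)).trans
      (indicator_le_indicator_of_subset (monotone_spanningSets μ hkl) (fun _ => zero_le) x)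
  · refine (SimpleFunc.tendsto_eapprox hf x).congr' ?_
    filter_upwards [eventually_mem_spanningSets μ x] with k hk
    rw [happ, indicator_of_mem hk]

lemma comp_simpleFunc_eq_sum_indicator {α β : Type*} [MeasurableSpace α] (g : SimpleFunc α β)
    (F : β → ℝ≥0∞) (x : α) :
    F (g x) = ∑ y ∈ g.range, (g ⁻¹' {y}).indicator (fun _ => F y) x := by
  classical
  rw [Finset.sum_eq_single_of_mem (g x) (SimpleFunc.mem_range_self g x)]
  · simp
  · intro y _ hy
    exact indicator_of_notMem (fun h => hy h.symm) _

namespace MmWave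

variable {Ω : Type*}

lemma tsum_indicator_eq_mul_count (X : ℕ → Ω → Plane) (A : Set Plane) (c : ℝ≥0∞) (ω : Ω) :
    ∑' n, A.indicator (fun _ => c) (X n ω) = c * count X A ω := by
  rw [count, ← ENNReal.tsum_set_one, tsum_subtype _ (fun _ : ℕ => (1 : ℝ≥0∞)),
    ← ENNReal.tsum_mul_left]
  refine tsum_congr fun n => ?_
  by_cases h : X n ω ∈ A <;> simp [h]

namespace IsPoissonProcess

variable [MeasurableSpace Ω] {X : ℕ → Ω → Plane} {lam : ℝ} {P : Measure Ω}

lemma isProbabilityMeasure (h : IsPoissonProcess X lam P) : IsProbabilityMeasure P :=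
  (h.count_indep 0 Fin.elim0 nofun nofun).isProbabilityMeasure

lemma measurable_count (h : IsPoissonProcess X lam P) {A : Set Plane} (hA : MeasurableSet A) :
    Measurable (count X A) := by
  have hmeas : Measurable fun ω => (count X A ω : ℝ≥0∞) := by
    have htsum (ω : Ω) := one_mul (count X A ω : ℝ≥0∞) ▸ tsum_indicator_eq_mul_count X A 1 ω
    simp_rw [← htsum]
    exact Measurable.tsum fun n => (measurable_const.indicator hA).comp (h.measurable n)
  refine measurable_to_countable' fun k => ?_
  have hpre : count X A ⁻¹' {k} = (fun ω => (count X A ω : ℝ≥0∞)) ⁻¹' {(k : ℝ≥0∞)} := by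
    ext ω; simp
  exact hpre ▸ hmeas (measurableSet_singleton _)

lemma map_count (h : IsPoissonProcess X lam P) {A : Set Plane} (hA : MeasurableSet A)
    (hAfin : volume A ≠ ∞) :
    P.map (count X A) = (poissonMeasure (lam * volume.real A).toNNReal).map ((↑) : ℕ → ℕ∞) := by
  have := h.isProbabilityMeasure
  have hcount := h.measurable_count hA
  have := Measure.isProbabilityMeasure_map (μ := P) hcount.aemeasurable
  have hcast : MeasurableEmbedding ((↑) : ℕ → ℕ∞) :=
    ⟨Nat.cast_injective, .of_discrete, fun _ _ => .of_discrete⟩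
  have hcomap : (P.map (count X A)).comap ((↑) : ℕ → ℕ∞)
      = poissonMeasure (lam * volume.real A).toNNReal := by
    refine Measure.ext_of_singleton fun k => ?_
    rw [hcast.comap_apply, image_singleton, Measure.map_apply hcount (measurableSet_singleton _)]
    exact h.count_law A hA hAfin.lt_top k
  rw [← hcomap, hcast.map_comap]
  have := Measure.isProbabilityMeasure_map (μ := poissonMeasure (lam * volume.real A).toNNReal)
    hcast.measurable.aemeasurable
  rw [← hcomap, hcast.map_comap] at this
  exact (Measure.eq_of_le_of_measure_univ_eq Measure.restrict_le_self
    (by rw [measure_univ, measure_univ])).symm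

lemma lintegral_expNeg_mul_count (h : IsPoissonProcess X lam P) {A : Set Plane}
    (hA : MeasurableSet A) {c : ℝ≥0∞} (hc : c ≠ 0 → volume A ≠ ∞) :
    ∫⁻ ω, expNeg (c * count X A ω) ∂P
      = expNeg (ENNReal.ofReal lam * ((1 - expNeg c) * volume A)) := by
  have := h.isProbabilityMeasure
  rcases eq_or_ne c 0 with rfl | hc0
  · simp
  have hrate : ((lam * volume.real A).toNNReal : ℝ≥0∞) = ENNReal.ofReal lam * volume A := by
    rw [← ENNReal.ofReal_toReal (hc hc0), ← ENNReal.ofReal_mul' ENNReal.toReal_nonneg]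
    rfl
  calc ∫⁻ ω, expNeg (c * count X A ω) ∂P
      = ∫⁻ k, expNeg (c * k) ∂P.map (count X A) :=
        (lintegral_map (f := fun k : ℕ∞ => expNeg (c * k)) .of_discrete
          (h.measurable_count hA)).symm
    _ = ∫⁻ n : ℕ, expNeg (c * n) ∂poissonMeasure (lam * volume.real A).toNNReal := by
        rw [h.map_count hA (hc hc0), lintegral_map .of_discrete .of_discrete]
        simp
    _ = expNeg (ENNReal.ofReal lam * ((1 - expNeg c) * volume A)) := by
        rw [lintegral_expNeg_poissonMeasure, hrate, mul_assoc, mul_comm (volume A)]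

lemma iIndepFun_count (h : IsPoissonProcess X lam P) {ι : Type*} [Finite ι] {A : ι → Set Plane}
    (hA : ∀ i, MeasurableSet (A i)) (hd : Pairwise fun i j => Disjoint (A i) (A j)) :
    iIndepFun (fun i => count X (A i)) P := by
  obtain ⟨n, ⟨e⟩⟩ := Finite.exists_equiv_fin ι
  simpa using (h.count_indep n (fun i => A (e.symm i)) (fun i => hA _)
    fun i j hij => hd (e.symm.injective.ne hij)).precomp e.injective

lemma lintegral_expNeg_tsum_simpleFunc (h : IsPoissonProcess X lam P)
    (g : SimpleFunc Plane ℝ≥0∞) (hg : g.FinMeasSupp volume) :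
    ∫⁻ ω, expNeg (∑' n, g (X n ω)) ∂P
      = expNeg (ENNReal.ofReal lam * ∫⁻ x, (1 - expNeg (g x))) := by
  have hfiber (y : ℝ≥0∞) : MeasurableSet (g ⁻¹' {y}) := g.measurableSet_preimage _
  have hsum (ω : Ω) : ∑' n, g (X n ω) = ∑ y : g.range, (y : ℝ≥0∞) * count X (g ⁻¹' {↑y}) ω := by
    rw [Finset.sum_coe_sort g.range fun y => y * (count X (g ⁻¹' {y}) ω : ℝ≥0∞)]
    simp_rw [← tsum_indicator_eq_mul_count]
    rw [← Summable.tsum_finsetSum fun _ _ => ENNReal.summable]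
    exact tsum_congr fun n => comp_simpleFunc_eq_sum_indicator g id _
  have hint : ∫⁻ x, (1 - expNeg (g x))
      = ∑ y : g.range, (1 - expNeg y) * volume (g ⁻¹' {(y : ℝ≥0∞)}) := by
    rw [Finset.sum_coe_sort g.range fun y => (1 - expNeg y) * volume (g ⁻¹' {y}),
      lintegral_congr (comp_simpleFunc_eq_sum_indicator g fun y => 1 - expNeg y),
      lintegral_finsetSum _ fun y _ => measurable_const.indicator (hfiber y)]
    exact Finset.sum_congr rfl fun y _ => lintegral_indicator_const (hfiber y) _
  have hind : iIndepFun (fun (y : g.range) ω => expNeg (y * count X (g ⁻¹' {↑y}) ω)) P :=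
    (h.iIndepFun_count (fun y : g.range => hfiber y) fun y z hyz =>
      Disjoint.preimage g (disjoint_singleton.2 (Subtype.coe_injective.ne hyz))).comp
      (fun y k => expNeg (y * k)) fun _ => .of_discrete
  have hmeas (y : g.range) : Measurable fun ω => expNeg (y * count X (g ⁻¹' {↑y}) ω) :=
    (Measurable.of_discrete (f := fun k : ℕ∞ => expNeg (y * k))).comp
      (h.measurable_count (hfiber y))
  simp_rw [hsum, expNeg_sum, hint, Finset.mul_sum, expNeg_sum]
  rw [lintegral_prod_eq_prod_lintegral_of_indepFun Finset.univ _ hind hmeas]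
  exact Finset.prod_congr rfl fun y _ => h.lintegral_expNeg_mul_count (hfiber y) fun hy =>
    (SimpleFunc.finMeasSupp_iff.1 hg y hy).ne

theorem lintegral_expNeg_tsum (h : IsPoissonProcess X lam P) {f : Plane → ℝ≥0∞}
    (hf : Measurable f) :
    ∫⁻ ω, expNeg (∑' n, f (X n ω)) ∂P
      = expNeg (ENNReal.ofReal lam * ∫⁻ x, (1 - expNeg (f x))) := by
  have := h.isProbabilityMeasure
  obtain ⟨g, hsupp, hmono, hlim⟩ := exists_monotone_finMeasSupp_tendsto volume hf
  have hleft : Tendsto (fun k => ∫⁻ ω, expNeg (∑' n, g k (X n ω)) ∂P) atTop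
      (𝓝 (∫⁻ ω, expNeg (∑' n, f (X n ω)) ∂P)) := by
    refine tendsto_lintegral_expNeg (fun k => (Measurable.tsum fun n =>
      (g k).measurable.comp (h.measurable n)).aemeasurable) fun ω => ?_
    simpa only [lintegral_count] using lintegral_tendsto_of_tendsto_of_monotone
      (μ := (Measure.count : Measure ℕ)) (f := fun k n => g k (X n ω)) (F := fun n => f (X n ω))
      (fun k => Measurable.of_discrete.aemeasurable)
      (Eventually.of_forall fun n _ _ hkl => hmono hkl _) (Eventually.of_forall fun n => hlim _)
  have hright : Tendsto (fun k => ∫⁻ x, (1 - expNeg (g k x))) atTop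
      (𝓝 (∫⁻ x, (1 - expNeg (f x)))) :=
    lintegral_tendsto_of_tendsto_of_monotone
      (fun k => (measurable_const.sub (measurable_expNeg.comp (g k).measurable)).aemeasurable)
      (Eventually.of_forall fun x _ _ hkl => tsub_le_tsub_left (antitone_expNeg (hmono hkl x)) _)
      (Eventually.of_forall fun x => ENNReal.Tendsto.sub tendsto_const_nhds
        ((continuous_expNeg.tendsto _).comp (hlim x)) (Or.inl ENNReal.one_ne_top))
  refine tendsto_nhds_unique hleft ?_
  simp_rw [h.lintegral_expNeg_tsum_simpleFunc _ (hsupp _)]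
  exact (continuous_expNeg.tendsto _).comp
    (ENNReal.Tendsto.const_mul hright (Or.inr ENNReal.ofReal_ne_top))

lemma ae_notMem_of_volume_eq_zero (h : IsPoissonProcess X lam P) {A : Set Plane}
    (hA : MeasurableSet A) (hA0 : volume A = 0) : ∀ᵐ ω ∂P, ∀ n, X n ω ∉ A := by
  have := h.isProbabilityMeasure
  have hempty : P {ω | count X A ω = 0} = 1 := by
    simpa [measureReal_def, hA0, poissonMeasure_singleton] using h.count_law A hA (by simp [hA0]) 0
  filter_upwards [(mem_ae_iff_prob_eq_one (h.measurable_count hA (measurableSet_singleton 0))).2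
    hempty] with ω hω
  exact eq_empty_iff_forall_notMem.1 (encard_eq_zero.1 hω)

end IsPoissonProcess

end MmWave

/-! ### The signal of a single link -/

namespace MmWave

lemma LinkType.sum_univ {M : Type*} [AddCommMonoid M] (f : LinkType → M) :
    ∑ j, f j = f .los + f .nlos :=
  Finset.sum_pair (by decide)

lemma Lobe.sum_univ {M : Type*} [AddCommMonoid M] (f : Lobe → M) :
    ∑ V, f V = f .main + f .side :=
  Finset.sum_pair (by decide)

instance : IsProbabilityMeasure (ProbabilityTheory.cond volume (Icc (0 : ℝ) 1)) :=
  cond_isProbabilityMeasure_of_finite (by simp) (by simp)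

instance : IsProbabilityMeasure (ProbabilityTheory.cond volume (Icc (-180 : ℝ) 180)) :=
  cond_isProbabilityMeasure_of_finite (by simp) (by simp)

namespace Params

variable (p : Params)

instance (j : LinkType) : IsProbabilityMeasure (gammaMeasure (p.shape j) 1) :=
  isProbabilityMeasure_gammaMeasure (by exact_mod_cast p.shape_pos j) one_pos

instance : IsProbabilityMeasure p.linkLaw := by unfold linkLaw; infer_instance

instance : IsProbabilityMeasure p.eveLinkLaw := by unfold eveLinkLaw; infer_instance

lemma alpha_pos : ∀ j, 0 < p.alpha j
  | .los => p.alpha_los_pos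
  | .nlos => two_pos.trans p.two_lt_alpha_nlos

lemma measurable_pathLoss (j : LinkType) : Measurable (p.pathLoss j) := by
  unfold pathLoss; fun_prop

lemma losProb_nonneg (r : ℝ) : 0 ≤ p.losProb r := by
  unfold losProb; split_ifs; exacts [p.C_nonneg, le_rfl]

lemma losProb_le_one (r : ℝ) : p.losProb r ≤ 1 := by
  unfold losProb; split_ifs; exacts [p.C_le_one, zero_le_one]

lemma measurable_losProb : Measurable p.losProb :=
  Measurable.ite measurableSet_Iic measurable_const measurable_const

lemma measurable_comp_linkType {α β : Type*} [MeasurableSpace α] [MeasurableSpace β]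
    {u r : α → ℝ} {f : LinkType → α → β} (hu : Measurable u) (hr : Measurable r)
    (hf : ∀ j, Measurable (f j)) : Measurable fun x => f (p.linkType (u x) (r x)) x := by
  simp only [linkType, apply_ite f, ite_apply]
  exact Measurable.ite (measurableSet_lt hu (p.measurable_losProb.comp hr)) (hf _) (hf _)

/-- The probability that a link of length `r` has type `j`. -/
noncomputable def typeProb (r : ℝ) : LinkType → ℝ
  | .los => p.losProb r
  | .nlos => 1 - p.losProb r

lemma typeProb_nonneg (r : ℝ) : ∀ j, 0 ≤ p.typeProb r j
  | .los => p.losProb_nonneg r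
  | .nlos => sub_nonneg.2 (p.losProb_le_one r)

lemma sum_typeProb (r : ℝ) : ∑ j, p.typeProb r j = 1 := by
  rw [LinkType.sum_univ, typeProb, typeProb, add_sub_cancel]

lemma typeProb_of_le {r : ℝ} (hr : r ≤ p.D) : p.typeProb r = p.q := by
  ext j
  cases j <;> simp [q, typeProb, losProb, hr]

lemma sum_typeProb_mul_of_lt {r : ℝ} (hr : p.D < r) (f : LinkType → ℝ) :
    ∑ j, p.typeProb r j * f j = f .nlos := by
  simp [LinkType.sum_univ, typeProb, losProb, hr.not_ge]

lemma cond_Icc_setOf_lt_losProb (r : ℝ) :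
    ProbabilityTheory.cond volume (Icc (0 : ℝ) 1) {u | u < p.losProb r}
      = ENNReal.ofReal (p.losProb r) := by
  have hset : Icc (0 : ℝ) 1 ∩ {u | u < p.losProb r} = Ico 0 (p.losProb r) := by
    ext u
    have := p.losProb_le_one r
    simp only [mem_inter_iff, mem_Icc, mem_ofPred_eq, mem_Ico]
    exact ⟨fun h => ⟨h.1.1, h.2⟩, fun h => ⟨⟨h.1, by linarith⟩, h.2⟩⟩
  rw [cond_apply measurableSet_Icc, hset]
  simp

lemma lintegral_comp_linkType (r : ℝ) (f : LinkType → ℝ≥0∞) :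
    ∫⁻ u, f (p.linkType u r) ∂(ProbabilityTheory.cond volume (Icc (0 : ℝ) 1))
      = ∑ j, ENNReal.ofReal (p.typeProb r j) * f j := by
  simp only [linkType, apply_ite f]
  rw [lintegral_ite_of_measure_eq_ofReal measurableSet_Iio (p.losProb_nonneg r)
    (p.cond_Icc_setOf_lt_losProb r), LinkType.sum_univ, typeProb, typeProb]

/-- The lobe of the serving antenna seen under the angle `θ`. -/
noncomputable def lobe (θ : ℝ) : Lobe := if |θ| ≤ p.beam then .main else .side

lemma pattern_eq_gain_lobe (θ : ℝ) : p.pattern θ = p.gain (p.lobe θ) :=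
  (apply_ite p.gain _ _ _).symm

lemma measurable_pattern : Measurable p.pattern :=
  Measurable.ite (measurableSet_le (by fun_prop) measurable_const) measurable_const
    measurable_const

lemma lobeProb_nonneg : ∀ V, 0 ≤ p.lobeProb V
  | .main => div_nonneg p.beam_nonneg (by norm_num)
  | .side => div_nonneg (sub_nonneg.2 p.beam_le) (by norm_num)

lemma sum_lobeProb : ∑ V, p.lobeProb V = 1 := by
  rw [Lobe.sum_univ, lobeProb, lobeProb]
  ring

lemma cond_Icc_setOf_abs_le_beam :
    ProbabilityTheory.cond volume (Icc (-180 : ℝ) 180) {θ | |θ| ≤ p.beam}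
      = ENNReal.ofReal (p.lobeProb .main) := by
  have hset : Icc (-180 : ℝ) 180 ∩ {θ | |θ| ≤ p.beam} = Icc (-p.beam) p.beam := by
    ext θ
    have := p.beam_le
    simp only [mem_inter_iff, mem_Icc, mem_ofPred_eq, abs_le]
    exact ⟨fun h => h.2, fun h => ⟨⟨by linarith, by linarith⟩, h⟩⟩
  rw [cond_apply measurableSet_Icc, hset, Real.volume_Icc, Real.volume_Icc,
    ← ENNReal.ofReal_inv_of_pos (by norm_num), ← ENNReal.ofReal_mul (by norm_num), lobeProb]
  ring_nf

lemma lintegral_comp_lobe (f : Lobe → ℝ≥0∞) :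
    ∫⁻ θ, f (p.lobe θ) ∂(ProbabilityTheory.cond volume (Icc (-180 : ℝ) 180))
      = ∑ V, ENNReal.ofReal (p.lobeProb V) * f V := by
  have hside : p.lobeProb .side = 1 - p.lobeProb .main := by
    rw [← p.sum_lobeProb, Lobe.sum_univ, add_sub_cancel_left]
  simp only [lobe, apply_ite f]
  rw [lintegral_ite_of_measure_eq_ofReal (measurableSet_le (by fun_prop) measurable_const)
    (p.lobeProb_nonneg .main) p.cond_Icc_setOf_abs_le_beam, Lobe.sum_univ, hside]

/-- The signal received over a link of length `r` with angle, blockage and fading marks `k`. -/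
noncomputable def signal (r : ℝ) (k : ℝ × (ℝ × (LinkType → ℝ))) : ℝ :=
  p.pattern k.1 * p.pathLoss (p.linkType k.2.1 r) r * k.2.2 (p.linkType k.2.1 r)

lemma measurable_signal : Measurable (Function.uncurry p.signal) := by
  have hpattern := p.measurable_pattern
  have hpathLoss := p.measurable_pathLoss
  exact p.measurable_comp_linkType (α := ℝ × (ℝ × (ℝ × (LinkType → ℝ)))) (u := fun x => x.2.2.1)
    (r := fun x => x.1) (f := fun j x => p.pattern x.2.1 * p.pathLoss j x.1 * x.2.2.2 j)
    (by fun_prop) (by fun_prop) (by fun_prop)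

/-- The Laplace defect `1 - E[exp (-s S)]` at `s` of the signal `S` received through the lobe `V`
over a link of length `r` and type `j`. -/
noncomputable def sectorDefect (s : ℝ) (V : Lobe) (j : LinkType) (r : ℝ) : ℝ :=
  1 - ((1 + s * (p.gain V * p.coef j * r ^ (-p.alpha j))) ^ p.shape j)⁻¹

/-- The Laplace defect `1 - E[exp (-s S)]` at `s` of the signal `S` received over a link of length
`r`, averaged over its lobe and its type. -/
noncomputable def linkDefect (s r : ℝ) : ℝ :=
  ∑ V, p.lobeProb V * ∑ j, p.typeProb r j * p.sectorDefect s V j r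

section Defect

variable {s t r : ℝ} (V : Lobe) (j : LinkType)

lemma gain_mul_coef_mul_rpow_nonneg (hr : 0 ≤ r) :
    0 ≤ p.gain V * p.coef j * r ^ (-p.alpha j) :=
  mul_nonneg (mul_pos (p.gain_pos V) (p.coef_pos j)).le (Real.rpow_nonneg hr _)

lemma sectorDefect_le_one (hs : 0 ≤ s) (hr : 0 ≤ r) : p.sectorDefect s V j r ≤ 1 := by
  have := p.gain_mul_coef_mul_rpow_nonneg V j hr
  exact sub_le_self _ (by positivity)

lemma sectorDefect_mono (hs : 0 ≤ s) (hst : s ≤ t) (hr : 0 ≤ r) :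
    p.sectorDefect s V j r ≤ p.sectorDefect t V j r := by
  have := p.gain_mul_coef_mul_rpow_nonneg V j hr
  unfold sectorDefect
  gcongr

lemma sectorDefect_zero (r : ℝ) : p.sectorDefect 0 V j r = 0 := by simp [sectorDefect]

lemma continuousAt_sectorDefect_zero (r : ℝ) :
    ContinuousAt (fun s => p.sectorDefect s V j r) 0 :=
  continuousAt_const.sub (ContinuousAt.inv₀ (by fun_prop) (by simp))

lemma linkDefect_mono (hs : 0 ≤ s) (hst : s ≤ t) (hr : 0 ≤ r) :
    p.linkDefect s r ≤ p.linkDefect t r :=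
  Finset.sum_le_sum fun V _ => mul_le_mul_of_nonneg_left (Finset.sum_le_sum fun j _ =>
    mul_le_mul_of_nonneg_left (p.sectorDefect_mono V j hs hst hr) (p.typeProb_nonneg r j))
    (p.lobeProb_nonneg V)

lemma linkDefect_zero (r : ℝ) : p.linkDefect 0 r = 0 := by
  simp [linkDefect, sectorDefect_zero]

lemma linkDefect_nonneg (hs : 0 ≤ s) (hr : 0 ≤ r) : 0 ≤ p.linkDefect s r :=
  (p.linkDefect_zero r).ge.trans (p.linkDefect_mono le_rfl hs hr)

lemma continuousAt_linkDefect_zero (r : ℝ) : ContinuousAt (fun s => p.linkDefect s r) 0 :=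
  tendsto_finsetSum _ fun V _ => (tendsto_finsetSum _ fun j _ =>
    (p.continuousAt_sectorDefect_zero V j r).const_mul _).const_mul _

lemma one_sub_linkDefect (s r : ℝ) :
    1 - p.linkDefect s r
      = ∑ V, p.lobeProb V * ∑ j, p.typeProb r j * (1 - p.sectorDefect s V j r) := by
  simp only [mul_sub, mul_one, Finset.sum_sub_distrib, p.sum_typeProb, p.sum_lobeProb, linkDefect]

lemma lintegral_expNeg_fading (ht : 0 ≤ t) :
    ∫⁻ g : LinkType → ℝ, expNeg (ENNReal.ofReal (t * g j))
        ∂(Measure.pi fun j => gammaMeasure (p.shape j) 1)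
      = ENNReal.ofReal (((1 + t) ^ p.shape j)⁻¹) := by
  have hshape : (0 : ℝ) < p.shape j := by exact_mod_cast p.shape_pos j
  rw [(measurePreserving_eval (fun j => gammaMeasure (p.shape j) 1) j).lintegral_comp
    (f := fun x => expNeg (ENNReal.ofReal (t * x))) (measurable_expNeg.comp (by fun_prop)),
    lintegral_expNeg_mul_gammaMeasure hshape one_pos ht, Real.rpow_natCast, one_div, inv_pow]

lemma lintegral_expNeg_signal_linkLaw (hs : 0 ≤ s) (hr : 0 ≤ r) (θ : ℝ) :
    ∫⁻ k, expNeg (ENNReal.ofReal (s * p.signal r (θ, k))) ∂p.linkLaw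
      = ∑ j, ENNReal.ofReal (p.typeProb r j) *
          ENNReal.ofReal (1 - p.sectorDefect s (p.lobe θ) j r) := by
  have hsignal := p.measurable_signal
  have hmeas : Measurable fun k => expNeg (ENNReal.ofReal (s * p.signal r (θ, k))) :=
    measurable_expNeg.comp (Measurable.ennreal_ofReal (Measurable.const_mul
      (hsignal.comp (f := fun k => (r, (θ, k))) (by fun_prop)) s))
  rw [linkLaw, lintegral_prod _ hmeas.aemeasurable, ← p.lintegral_comp_linkType r]
  refine lintegral_congr fun u => ?_
  have hnonneg := mul_nonneg hs (p.gain_mul_coef_mul_rpow_nonneg (p.lobe θ) (p.linkType u r) hr)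
  rw [sectorDefect, sub_sub_cancel, ← p.lintegral_expNeg_fading _ hnonneg]
  simp only [signal, pattern_eq_gain_lobe, pathLoss, mul_assoc]

lemma lintegral_expNeg_signal (hs : 0 ≤ s) (hr : 0 ≤ r) :
    ∫⁻ k, expNeg (ENNReal.ofReal s * ENNReal.ofReal (p.signal r k)) ∂p.eveLinkLaw
      = ENNReal.ofReal (1 - p.linkDefect s r) := by
  have hsignal : Measurable (p.signal r) := p.measurable_signal.of_uncurry_left
  have hmeas : Measurable fun k => expNeg (ENNReal.ofReal (s * p.signal r k)) :=
    measurable_expNeg.comp (by fun_prop)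
  have hnonneg (V : Lobe) (j : LinkType) : 0 ≤ p.typeProb r j * (1 - p.sectorDefect s V j r) :=
    mul_nonneg (p.typeProb_nonneg r j) (sub_nonneg.2 (p.sectorDefect_le_one V j hs hr))
  simp only [← ENNReal.ofReal_mul hs]
  rw [eveLinkLaw, lintegral_prod _ hmeas.aemeasurable, one_sub_linkDefect,
    ENNReal.ofReal_sum_of_nonneg fun V _ =>
      mul_nonneg (p.lobeProb_nonneg V) (Finset.sum_nonneg fun j _ => hnonneg V j)]
  simp only [ENNReal.ofReal_mul (p.lobeProb_nonneg _),
    ENNReal.ofReal_sum_of_nonneg fun j _ => hnonneg _ j, ENNReal.ofReal_mul (p.typeProb_nonneg r _),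
    p.lintegral_expNeg_signal_linkLaw hs hr]
  exact p.lintegral_comp_lobe fun V => ∑ j, ENNReal.ofReal (p.typeProb r j) *
    ENNReal.ofReal (1 - p.sectorDefect s V j r)

end Defect

/-! ### The Laplace exponent -/

section RadialDefect

variable {s : ℝ}

lemma linkDefect_le_one (hs : 0 ≤ s) {r : ℝ} (hr : 0 ≤ r) : p.linkDefect s r ≤ 1 := by
  rw [← sub_nonneg, one_sub_linkDefect]
  exact Finset.sum_nonneg fun V _ => mul_nonneg (p.lobeProb_nonneg V) <|
    Finset.sum_nonneg fun j _ => mul_nonneg (p.typeProb_nonneg r j) <|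
      sub_nonneg.2 (p.sectorDefect_le_one V j hs hr)

lemma integral_Ioc_mul_linkDefect (hs : 0 < s) :
    IntegrableOn (fun r => r * p.linkDefect s r) (Ioc 0 p.D) ∧
      ∫ r in Ioc 0 p.D, r * p.linkDefect s r = s * ∑ j, p.q j * ∑ V, p.lobeProb V *
        ((p.gain V * p.coef j) ^ (2 / p.alpha j) / p.alpha j) *
          nearSeries (2 / p.alpha j) (p.shape j) (p.edge j V) s := by
  have hnear (j : LinkType) (V : Lobe) := integral_Ioc_mul_one_sub_inv (p.alpha_pos j)
    (mul_pos (p.gain_pos V) (p.coef_pos j)) hs p.D_pos (p.shape j)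
  have hint (j : LinkType) (V : Lobe) : IntegrableOn
      (fun r => p.q j * p.lobeProb V * (r * p.sectorDefect s V j r)) (Ioc 0 p.D) :=
    (hnear j V).1.const_mul _
  have heq : EqOn (fun r => r * p.linkDefect s r) (fun r => ∑ j, ∑ V,
      p.q j * p.lobeProb V * (r * p.sectorDefect s V j r)) (Ioc 0 p.D) := fun r hr => by
    simp only [linkDefect, p.typeProb_of_le hr.2, Finset.mul_sum]
    rw [Finset.sum_comm]
    exact Finset.sum_congr rfl fun j _ => Finset.sum_congr rfl fun V _ => by ring
  refine ⟨(integrableOn_congr_fun heq measurableSet_Ioc).2 <|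
    integrable_finsetSum _ fun j _ => integrable_finsetSum _ fun V _ => hint j V, ?_⟩
  rw [setIntegral_congr_fun measurableSet_Ioc heq,
    integral_finsetSum _ fun j _ => integrable_finsetSum _ fun V _ => hint j V, Finset.mul_sum]
  refine Finset.sum_congr rfl fun j _ => ?_
  rw [integral_finsetSum _ fun V _ => hint j V, Finset.mul_sum, Finset.mul_sum]
  refine Finset.sum_congr rfl fun V _ => ?_
  unfold sectorDefect
  rw [integral_const_mul, (hnear j V).2, edge]
  ring

lemma integral_Ioi_mul_linkDefect (hs : 0 < s) :
    IntegrableOn (fun r => r * p.linkDefect s r) (Ioi p.D) ∧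
      ∫ r in Ioi p.D, r * p.linkDefect s r = s * ∑ V, p.lobeProb V *
        ((p.gain V * p.coef .nlos) ^ (2 / p.alpha .nlos) / p.alpha .nlos) *
          farSeries (2 / p.alpha .nlos) (p.shape .nlos) (p.edge .nlos V) s := by
  have hfar (V : Lobe) := integral_Ioi_mul_one_sub_inv p.two_lt_alpha_nlos
    (mul_pos (p.gain_pos V) (p.coef_pos .nlos)) hs p.D_pos (p.shape .nlos)
  have hint (V : Lobe) : IntegrableOn
      (fun r => p.lobeProb V * (r * p.sectorDefect s V .nlos r)) (Ioi p.D) :=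
    (hfar V).1.const_mul _
  have heq : EqOn (fun r => r * p.linkDefect s r) (fun r => ∑ V,
      p.lobeProb V * (r * p.sectorDefect s V .nlos r)) (Ioi p.D) := fun r hr => by
    simp only [linkDefect, p.sum_typeProb_mul_of_lt hr, Finset.mul_sum]
    exact Finset.sum_congr rfl fun V _ => by ring
  refine ⟨(integrableOn_congr_fun heq measurableSet_Ioi).2 <|
    integrable_finsetSum _ fun V _ => hint V, ?_⟩
  rw [setIntegral_congr_fun measurableSet_Ioi heq, integral_finsetSum _ fun V _ => hint V,
    Finset.mul_sum]
  refine Finset.sum_congr rfl fun V _ => ?_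
  unfold sectorDefect
  rw [integral_const_mul, (hfar V).2, edge]
  ring

lemma integrable_linkDefect_norm (hs : 0 < s) :
    Integrable fun x : Plane => p.linkDefect s ‖x‖ := by
  have hdim : Module.finrank ℝ Plane = 2 := by simp
  rw [integrable_fun_norm_addHaar volume (f := fun r => p.linkDefect s r), hdim,
    ← Ioc_union_Ioi_eq_Ioi p.D_pos.le]
  simpa using (p.integral_Ioc_mul_linkDefect hs).1.union (p.integral_Ioi_mul_linkDefect hs).1

theorem integral_linkDefect_norm (hs : 0 < s) :
    p.lamE * ∫ x : Plane, p.linkDefect s ‖x‖ = -p.Xi s := by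
  obtain ⟨hnear, hnear_eq⟩ := p.integral_Ioc_mul_linkDefect hs
  obtain ⟨hfar, hfar_eq⟩ := p.integral_Ioi_mul_linkDefect hs
  have hdim : Module.finrank ℝ Plane = 2 := by simp
  have hball : volume.real (Metric.ball (0 : Plane) 1) = Real.pi := by
    simp [Measure.real, Real.pi_pos.le]
  have hpolar : ∫ x : Plane, p.linkDefect s ‖x‖
      = 2 * Real.pi * ∫ r in Ioi 0, r * p.linkDefect s r := by
    rw [integral_fun_norm_addHaar volume fun r => p.linkDefect s r, hdim, hball]
    simp [mul_assoc]
  rw [hpolar, ← Ioc_union_Ioi_eq_Ioi p.D_pos.le, setIntegral_union (Ioc_disjoint_Ioi le_rfl)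
    measurableSet_Ioi hnear hfar, hnear_eq, hfar_eq, Xi]
  simp only [nearSeries, farSeries]
  ring

lemma Xi_nonpos (hs : 0 < s) : p.Xi s ≤ 0 := by
  rw [← neg_nonneg, ← p.integral_linkDefect_norm hs]
  exact mul_nonneg p.lamE_pos.le
    (integral_nonneg fun x => p.linkDefect_nonneg hs.le (norm_nonneg x))

lemma lintegral_linkDefect_norm (hs : 0 < s) :
    ENNReal.ofReal p.lamE * ∫⁻ x : Plane, ENNReal.ofReal (p.linkDefect s ‖x‖)
      = ENNReal.ofReal (-p.Xi s) := by
  rw [← ofReal_integral_eq_lintegral_ofReal (p.integrable_linkDefect_norm hs)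
    (Eventually.of_forall fun x => p.linkDefect_nonneg hs.le (norm_nonneg x)),
    ← ENNReal.ofReal_mul p.lamE_pos.le, p.integral_linkDefect_norm hs]

lemma tendsto_integral_linkDefect_norm :
    Tendsto (fun s => ∫ x : Plane, p.linkDefect s ‖x‖) (𝓝[>] 0) (𝓝 0) := by
  have hunit : ∀ᶠ s : ℝ in 𝓝[>] 0, s ∈ Ioo 0 1 := Ioo_mem_nhdsGT one_pos
  suffices Tendsto (fun s => ∫ x : Plane, p.linkDefect s ‖x‖) (𝓝[>] 0)
      (𝓝 (∫ _ : Plane, (0 : ℝ))) by simpa only [integral_zero] using this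
  refine tendsto_integral_filter_of_dominated_convergence (fun x => p.linkDefect 1 ‖x‖)
    (hunit.mono fun s hs => (p.integrable_linkDefect_norm hs.1).aestronglyMeasurable)
    (hunit.mono fun s hs => Eventually.of_forall fun x => ?_)
    (p.integrable_linkDefect_norm one_pos) (Eventually.of_forall fun x => ?_)
  · rw [Real.norm_of_nonneg (p.linkDefect_nonneg hs.1.le (norm_nonneg x))]
    exact p.linkDefect_mono hs.1.le hs.2.le (norm_nonneg x)
  · have hcont := p.continuousAt_linkDefect_zero ‖x‖
    rw [ContinuousAt, linkDefect_zero] at hcont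
    exact hcont.mono_left nhdsWithin_le_nhds

end RadialDefect

lemma tendsto_expXi_zero : Tendsto p.expXi (𝓝[>] 0) (𝓝 1) := by
  have hlim := (Real.continuous_exp.tendsto _).comp
    (p.tendsto_integral_linkDefect_norm.const_mul p.lamE).neg
  rw [mul_zero, neg_zero, Real.exp_zero] at hlim
  refine hlim.congr' ?_
  filter_upwards [self_mem_nhdsWithin] with s hs
  rw [Function.comp_apply, p.integral_linkDefect_norm hs, neg_neg, expXi]

end Params

/-! ### The aggregate signal at the eavesdroppers -/

/-- A configuration of the eavesdroppers: their locations and the marks of all links towards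
them. -/
abbrev EveConfiguration := (ℕ → Plane) × (ℕ × ℕ → ℝ × (ℝ × (LinkType → ℝ)))

namespace Params

variable (p : Params)

/-- The aggregate signal received by the eavesdroppers from base station `i` located at `x`. -/
noncomputable def aggregate (i : ℕ) (x : Plane) (z : EveConfiguration) : ℝ≥0∞ :=
  ∑' n, ENNReal.ofReal (p.signal (dist x (z.1 n)) (z.2 (i, n)))

lemma measurable_aggregate (i : ℕ) :
    Measurable fun a : Plane × EveConfiguration => p.aggregate i a.1 a.2 :=
  Measurable.tsum fun n => (p.measurable_signal.comp (by fun_prop : Measurable fun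
    a : Plane × EveConfiguration => (dist a.1 (a.2.1 n), a.2.2 (i, n)))).ennreal_ofReal

/-- The law of the marks of all links towards the eavesdroppers. -/
noncomputable def eveMarksLaw : Measure (ℕ × ℕ → ℝ × (ℝ × (LinkType → ℝ))) :=
  Measure.infinitePi fun _ => p.eveLinkLaw

instance : IsProbabilityMeasure p.eveMarksLaw := by unfold eveMarksLaw; infer_instance

lemma measurable_linkDefect (s : ℝ) : Measurable (p.linkDefect s) := by
  have htype (j : LinkType) : Measurable fun r => p.typeProb r j := by
    cases j
    exacts [p.measurable_losProb, measurable_const.sub p.measurable_losProb]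
  unfold linkDefect sectorDefect
  fun_prop

lemma measurable_negLog_linkDefect (s : ℝ) (x : Plane) :
    Measurable fun z => negLog (ENNReal.ofReal (1 - p.linkDefect s (dist x z))) :=
  measurable_negLog.comp (measurable_const.sub
    ((p.measurable_linkDefect s).comp (measurable_const.dist measurable_id))).ennreal_ofReal

variable {s : ℝ}

lemma lintegral_expNeg_aggregate_marks (hs : 0 ≤ s) (i : ℕ) (x : Plane) (e : ℕ → Plane) :
    ∫⁻ m, expNeg (ENNReal.ofReal s * p.aggregate i x (e, m)) ∂p.eveMarksLaw
      = expNeg (∑' n, negLog (ENNReal.ofReal (1 - p.linkDefect s (dist x (e n))))) := by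
  have hsig (n : ℕ) : Measurable fun k =>
      ENNReal.ofReal s * ENNReal.ofReal (p.signal (dist x (e n)) k) :=
    measurable_const.mul p.measurable_signal.of_uncurry_left.ennreal_ofReal
  have hind : iIndepFun (fun n (m : ℕ × ℕ → ℝ × (ℝ × (LinkType → ℝ))) =>
      ENNReal.ofReal s * ENNReal.ofReal (p.signal (dist x (e n)) (m (i, n)))) p.eveMarksLaw :=
    ((iIndepFun_infinitePi (P := fun _ => p.eveLinkLaw) (X := fun _ k => k) fun _ =>
      measurable_id).precomp (Prod.mk_right_injective i)).comp _ hsig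
  simp only [aggregate, ← ENNReal.tsum_mul_left]
  refine (lintegral_expNeg_tsum (fun n => (hsig n).comp (measurable_pi_apply (i, n))) hind).trans ?_
  congr! 4 with n
  rw [← p.lintegral_expNeg_signal hs dist_nonneg]
  exact (measurePreserving_eval_infinitePi (fun _ => p.eveLinkLaw) (i, n)).lintegral_comp
    (measurable_expNeg.comp (hsig n))

variable {Ω : Type*} [MeasurableSpace Ω] {P : Measure Ω} {X : ℕ → Ω → Plane}

lemma lintegral_expNeg_tsum_negLog_linkDefect (hX : IsPoissonProcess X p.lamE P) (hs : 0 < s)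
    (x : Plane) :
    ∫⁻ ω, expNeg (∑' n, negLog (ENNReal.ofReal (1 - p.linkDefect s (dist x (X n ω))))) ∂P
      = ENNReal.ofReal (p.expXi s) := by
  have hdefect (z : Plane) :
      1 - expNeg (negLog (ENNReal.ofReal (1 - p.linkDefect s (dist x z))))
        = ENNReal.ofReal (p.linkDefect s ‖z - x‖) := by
    have h0 := p.linkDefect_nonneg hs.le (dist_nonneg (x := x) (y := z))
    have h1 := p.linkDefect_le_one hs.le (dist_nonneg (x := x) (y := z))
    rw [expNeg_negLog (ENNReal.ofReal_le_one.2 (sub_le_self 1 h0)), ← ENNReal.ofReal_one,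
      ← ENNReal.ofReal_sub _ (sub_nonneg.2 h1), sub_sub_cancel, dist_comm, dist_eq_norm]
  rw [hX.lintegral_expNeg_tsum
    (f := fun z => negLog (ENNReal.ofReal (1 - p.linkDefect s (dist x z))))
    (p.measurable_negLog_linkDefect s x)]
  simp_rw [hdefect]
  rw [lintegral_sub_right_eq_self (fun z : Plane => ENNReal.ofReal (p.linkDefect s ‖z‖)) x,
    p.lintegral_linkDefect_norm hs, expNeg_ofReal (neg_nonneg.2 (p.Xi_nonpos hs)), neg_neg, expXi]

/-- The law of the configuration of the eavesdroppers when their locations are `X`. -/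
noncomputable def eveLaw (X : ℕ → Ω → Plane) (P : Measure Ω) : Measure EveConfiguration :=
  (P.map fun ω n => X n ω).prod p.eveMarksLaw

lemma isProbabilityMeasure_eveLaw (hX : IsPoissonProcess X p.lamE P) :
    IsProbabilityMeasure (p.eveLaw X P) := by
  have := hX.isProbabilityMeasure
  have := Measure.isProbabilityMeasure_map (μ := P)
    (measurable_pi_lambda _ hX.measurable).aemeasurable
  unfold eveLaw
  infer_instance

theorem lintegral_expNeg_aggregate (hX : IsPoissonProcess X p.lamE P) (hs : 0 < s) (i : ℕ)
    (x : Plane) :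
    ∫⁻ z, expNeg (ENNReal.ofReal s * p.aggregate i x z) ∂(p.eveLaw X P)
      = ENNReal.ofReal (p.expXi s) := by
  have hagg : Measurable fun z => expNeg (ENNReal.ofReal s * p.aggregate i x z) :=
    measurable_expNeg.comp (((p.measurable_aggregate i).comp measurable_prodMk_left).const_mul _)
  have hsum : Measurable fun e : ℕ → Plane =>
      expNeg (∑' n, negLog (ENNReal.ofReal (1 - p.linkDefect s (dist x (e n))))) :=
    measurable_expNeg.comp <| Measurable.tsum fun n =>
      (p.measurable_negLog_linkDefect s x).comp (measurable_pi_apply n)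
  rw [eveLaw, lintegral_prod _ hagg.aemeasurable]
  simp_rw [p.lintegral_expNeg_aggregate_marks hs.le]
  rw [lintegral_map hsum (measurable_pi_lambda _ hX.measurable),
    p.lintegral_expNeg_tsum_negLog_linkDefect hX hs]

theorem hasLaplaceTransform_aggregate (hX : IsPoissonProcess X p.lamE P) (i : ℕ) (x : Plane) :
    HasLaplaceTransform (p.aggregate i x) p.expXi (p.eveLaw X P) := by
  have := p.isProbabilityMeasure_eveLaw hX
  exact .of_lintegral_expNeg ((p.measurable_aggregate i).comp measurable_prodMk_left).aemeasurable
    (fun s hs => p.lintegral_expNeg_aggregate hX hs i x) (fun s _ => (Real.exp_pos _).le)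
    p.tendsto_expXi_zero

end Params

/-! ### The serving base station -/

/-- A configuration of the base stations: their locations and the blockage variables of their links
to the typical user. It determines the serving base station. -/
abbrev BaseConfiguration := (ℕ → Plane) × (ℕ → ℝ)

/-- The law of the blockage variables of the links to the typical user. -/
noncomputable def blockageLaw : Measure (ℕ → ℝ) :=
  Measure.infinitePi fun _ => ProbabilityTheory.cond volume (Icc (0 : ℝ) 1)

instance : IsProbabilityMeasure blockageLaw := by unfold blockageLaw; infer_instance

namespace Params

variable (p : Params)

/-- The law of the channel gains of the links to the typical user. -/
noncomputable def fadingLaw : Measure (ℕ → LinkType → ℝ) :=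
  Measure.infinitePi fun _ => Measure.pi fun j => gammaMeasure (p.shape j) 1

instance : IsProbabilityMeasure p.fadingLaw := by unfold fadingLaw; infer_instance

/-- The index of the serving base station. -/
noncomputable def servingIndex (u : BaseConfiguration) : ℕ :=
  sInf {i | ∀ k, p.pathLoss (p.linkType (u.2 k) ‖u.1 k‖) ‖u.1 k‖
    ≤ p.pathLoss (p.linkType (u.2 i) ‖u.1 i‖) ‖u.1 i‖}

/-- The distance from the typical user to its serving base station. -/
noncomputable def servingDist (u : BaseConfiguration) : ℝ := ‖u.1 (p.servingIndex u)‖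

/-- The type of the link from the serving base station to the typical user. -/
noncomputable def servingType (u : BaseConfiguration) : LinkType :=
  p.linkType (u.2 (p.servingIndex u)) (p.servingDist u)

lemma measurable_servingIndex : Measurable p.servingIndex := by
  have hpathLoss := p.measurable_pathLoss
  have hloss (k : ℕ) : Measurable fun u : BaseConfiguration =>
      p.pathLoss (p.linkType (u.2 k) ‖u.1 k‖) ‖u.1 k‖ :=
    p.measurable_comp_linkType (f := fun j (u : BaseConfiguration) => p.pathLoss j ‖u.1 k‖)
      (by fun_prop) (by fun_prop) (by fun_prop)
  exact measurable_nat_sInf.comp <| measurable_set_iff.2 fun i => .forall fun k =>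
    measurableSet_setOfPred.1 (measurableSet_le (hloss k) (hloss i))

lemma measurable_comp_serving {α β : Type*} [MeasurableSpace α] [MeasurableSpace β]
    {u : α → BaseConfiguration} {f : ℕ → LinkType → α → β} (hu : Measurable u)
    (hf : ∀ i j, Measurable (f i j)) :
    Measurable fun x => f (p.servingIndex (u x)) (p.servingType (u x)) x := by
  have hindex (i : ℕ) :
      Measurable fun x => f i (p.linkType ((u x).2 i) ‖(u x).1 i‖) x :=
    p.measurable_comp_linkType (by fun_prop) (by fun_prop) (hf i)
  exact (measurable_from_prod_countable_right (f := fun y : ℕ × α =>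
    f y.1 (p.linkType ((u y.2).2 y.1) ‖(u y.2).1 y.1‖) y.2) hindex).comp
    ((p.measurable_servingIndex.comp hu).prodMk measurable_id)

/-- The aggregate signal of the serving base station received by the eavesdroppers. -/
noncomputable def servingAggregate (u : BaseConfiguration) (z : EveConfiguration) : ℝ≥0∞ :=
  p.aggregate (p.servingIndex u) (u.1 (p.servingIndex u)) z

lemma measurable_servingAggregate :
    Measurable fun x : BaseConfiguration × EveConfiguration => p.servingAggregate x.1 x.2 := by
  have hagg (i : ℕ) : Measurable fun x : BaseConfiguration × EveConfiguration =>
      p.aggregate i (x.1.1 i) x.2 := by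
    have := p.measurable_aggregate i
    fun_prop
  unfold servingAggregate
  exact p.measurable_comp_serving (u := Prod.fst) (f := fun i _ x => p.aggregate i (x.1.1 i) x.2)
    measurable_fst fun i _ => hagg i

end Params

namespace Network

variable {Ω : Type*} [MeasurableSpace Ω] {p : Params} {P : Measure Ω} (W : Network p P)

/-- The configuration of the base stations. -/
def base (ω : Ω) : BaseConfiguration := (fun i => W.bs i ω, fun i => (W.userMark i ω).1)

/-- The random elements independent of `base`: the configuration of the eavesdroppers and the
channel gains of the links to the typical user. -/
def environment (ω : Ω) : EveConfiguration × (ℕ → LinkType → ℝ) :=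
  ((fun n => W.eve n ω, fun k => W.eveMark k ω), fun i => (W.userMark i ω).2)

/-- The law of `base`. -/
noncomputable def baseLaw : Measure BaseConfiguration :=
  (P.map fun ω i => W.bs i ω).prod blockageLaw

lemma measurable_bs : Measurable fun ω i => W.bs i ω :=
  measurable_pi_lambda _ W.bs_poisson.measurable

lemma hasLaw_userMark : HasLaw (fun ω => (fun i => (W.userMark i ω).1, fun i => (W.userMark i ω).2))
    (blockageLaw.prod p.fadingLaw) P :=
  (measurePreserving_arrowProdEquivProdArrow_infinitePi _ _).comp_hasLaw <|
    W.userMark_indep.hasLaw_infinitePi W.userMark_law <|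
      aemeasurable_pi_iff.2 fun i => (W.userMark_law i).aemeasurable

lemma hasLaw_eveMark : HasLaw (fun ω k => W.eveMark k ω) p.eveMarksLaw P :=
  W.eveMark_indep.hasLaw_infinitePi W.eveMark_law <|
    aemeasurable_pi_iff.2 fun k => (W.eveMark_law k).aemeasurable

lemma IE_eq_servingAggregate (ω : Ω) :
    W.IE ω = p.servingAggregate (W.base ω) (W.environment ω).1 := rfl

variable [IsProbabilityMeasure P]

instance : IsProbabilityMeasure W.baseLaw := by
  have := Measure.isProbabilityMeasure_map (μ := P) W.measurable_bs.aemeasurable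
  unfold baseLaw
  infer_instance

theorem hasLaw_base_environment : HasLaw (fun ω => (W.base ω, W.environment ω))
    (W.baseLaw.prod ((p.eveLaw W.eve P).prod p.fadingLaw)) P := by
  have hsplit := (MeasurableEquiv.arrowProdEquivProdArrow ℝ (LinkType → ℝ) ℕ).measurable
  have hbs := W.measurable_bs
  have heve := measurable_pi_lambda _ W.eve_poisson.measurable
  have := Measure.isProbabilityMeasure_map (μ := P) hbs.aemeasurable
  have := Measure.isProbabilityMeasure_map (μ := P) heve.aemeasurable
  have hmarks := (W.indep_marks.comp hsplit measurable_id).hasLaw_prod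
    W.hasLaw_userMark W.hasLaw_eveMark
  have henv := (W.indep_eve.comp measurable_id (hsplit.prodMap measurable_id)).hasLaw_prod
    ⟨heve.aemeasurable, rfl⟩ hmarks
  have hall := (W.indep_bs.comp measurable_id
    (measurable_id.prodMap (hsplit.prodMap measurable_id))).hasLaw_prod
    ⟨hbs.aemeasurable, rfl⟩ henv
  have hrearrange := measurePreserving_prod_rearrange (P.map fun ω i => W.bs i ω)
    (P.map fun ω n => W.eve n ω) blockageLaw p.fadingLaw p.eveMarksLaw
  exact hrearrange.comp_hasLaw hall

lemma hasLaw_base_eve : HasLaw (fun ω => (W.base ω, (W.environment ω).1))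
    (W.baseLaw.prod (p.eveLaw W.eve P)) P := by
  have := p.isProbabilityMeasure_eveLaw W.eve_poisson
  exact ((MeasurePreserving.id _).prod measurePreserving_fst).comp_hasLaw W.hasLaw_base_environment

lemma hasLaw_base : HasLaw W.base W.baseLaw P := by
  have := p.isProbabilityMeasure_eveLaw W.eve_poisson
  exact measurePreserving_fst.comp_hasLaw W.hasLaw_base_eve

theorem hasLaplaceTransform_IE : HasLaplaceTransform W.IE p.expXi P := by
  have := p.isProbabilityMeasure_eveLaw W.eve_poisson
  have hpair := W.hasLaw_base_eve
  have hY := p.measurable_servingAggregate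
  have hIE := hY.comp_aemeasurable hpair.aemeasurable
  refine .of_lintegral_expNeg (hIE.congr (.of_forall fun ω => (W.IE_eq_servingAggregate ω).symm))
    (fun s hs => ?_) (fun s _ => (Real.exp_pos _).le) p.tendsto_expXi_zero
  have hexp : Measurable fun x : BaseConfiguration × EveConfiguration =>
      expNeg (ENNReal.ofReal s * p.servingAggregate x.1 x.2) :=
    measurable_expNeg.comp (hY.const_mul _)
  have hlintegral := hpair.lintegral_comp hexp.aemeasurable
  rw [lintegral_prod _ hexp.aemeasurable] at hlintegral
  simp_rw [W.IE_eq_servingAggregate, hlintegral, Params.servingAggregate,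
    p.lintegral_expNeg_aggregate W.eve_poisson hs, lintegral_const, measure_univ, mul_one]

end Network

/-! ### The secure connectivity probability -/

namespace Params

variable (p : Params)

lemma gain_mul_pathLoss_pos (j : LinkType) {r : ℝ} (hr : 0 < r) :
    0 < p.gain .main * p.pathLoss j r :=
  mul_pos (p.gain_pos _) (mul_pos (p.coef_pos j) (Real.rpow_pos_of_pos hr _))

lemma inv_gain_mul_pathLoss (j : LinkType) {r : ℝ} (hr : 0 < r) :
    (p.gain .main * p.pathLoss j r)⁻¹ = p.arg j r := by
  rw [pathLoss, arg, Real.rpow_neg hr.le, ← mul_assoc, mul_inv, inv_inv, div_eq_inv_mul]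

lemma arg_pos (j : LinkType) {r : ℝ} (hr : 0 < r) : 0 < p.arg j r := by
  rw [← p.inv_gain_mul_pathLoss j hr]
  exact inv_pos.2 (p.gain_mul_pathLoss_pos j hr)

lemma measurable_arg (j : LinkType) : Measurable (p.arg j) := by
  unfold arg; fun_prop

lemma measurePreserving_eval_fadingLaw (i : ℕ) (j : LinkType) :
    MeasurePreserving (fun g : ℕ → LinkType → ℝ => g i j) p.fadingLaw
      (gammaMeasure (p.shape j) 1) :=
  (measurePreserving_eval (fun j => gammaMeasure (p.shape j) 1) j).comp
    (measurePreserving_eval_infinitePi (fun _ => Measure.pi fun j => gammaMeasure (p.shape j) 1) i)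

lemma fadingLaw_setOf_one_le_div (i : ℕ) (j : LinkType) {r : ℝ} (hr : 0 < r) {I : ℝ≥0∞}
    (hI : I ≠ ∞) :
    p.fadingLaw {g | 1 ≤ ENNReal.ofReal (p.gain .main * p.pathLoss j r * g i j) / I}
      = ENNReal.ofReal (erlangTail (p.shape j) (p.arg j r * I.toReal)) := by
  have hset : MeasurableSet {x : ℝ | 1 ≤ ENNReal.ofReal (p.gain .main * p.pathLoss j r * x) / I} :=
    measurableSet_le measurable_const (by fun_prop)
  rw [← p.inv_gain_mul_pathLoss j hr, ← gammaMeasure_setOf_one_le_div (p.shape_pos j).ne'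
    (p.gain_mul_pathLoss_pos j hr) hI]
  exact (p.measurePreserving_eval_fadingLaw i j).measure_preimage hset.nullMeasurableSet

/-- The ratio of the signal of the serving base station at the typical user to the aggregate
signal of the serving base station at the eavesdroppers. -/
noncomputable def signalRatio (u : BaseConfiguration)
    (y : EveConfiguration × (ℕ → LinkType → ℝ)) : ℝ≥0∞ :=
  ENNReal.ofReal (p.gain .main * p.pathLoss (p.servingType u) (p.servingDist u) *
    y.2 (p.servingIndex u) (p.servingType u)) / p.servingAggregate u y.1

lemma measurable_servingDist : Measurable p.servingDist :=
  p.measurable_comp_serving (u := id) (f := fun i _ u => ‖u.1 i‖) measurable_id (by fun_prop)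

lemma measurableSet_setOf_servingType_eq (j : LinkType) :
    MeasurableSet {u | p.servingType u = j} :=
  Measurable.setOf <| p.measurable_comp_serving (u := id) (f := fun _ k _ => k = j) measurable_id
    fun _ _ => measurable_const

lemma measurable_signalRatio :
    Measurable fun x : BaseConfiguration × EveConfiguration × (ℕ → LinkType → ℝ) =>
      p.signalRatio x.1 x.2 := by
  have hpathLoss := p.measurable_pathLoss
  have haggregate := p.measurable_servingAggregate
  have hsignal := p.measurable_comp_serving
    (u := fun x : BaseConfiguration × EveConfiguration × (ℕ → LinkType → ℝ) => x.1)
    (f := fun i j x => ENNReal.ofReal (p.gain .main * p.pathLoss j ‖x.1.1 i‖ * x.2.2 i j))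
    measurable_fst (by fun_prop)
  exact hsignal.div (by fun_prop)

end Params

namespace Network

variable {Ω : Type*} [MeasurableSpace Ω] {p : Params} {P : Measure Ω} (W : Network p P)

lemma nullMeasurableSet_servingType [IsProbabilityMeasure P] (j : LinkType) :
    NullMeasurableSet {ω | W.servingType ω = j} P :=
  W.hasLaw_base.aemeasurable.nullMeasurableSet_preimage (p.measurableSet_setOf_servingType_eq j)

lemma aemeasurable_servingDist [IsProbabilityMeasure P] : AEMeasurable W.servingDist P := by
  have hdist := p.measurable_servingDist.comp_aemeasurable W.hasLaw_base.aemeasurable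
  exact hdist

lemma ae_servingDist_pos : ∀ᵐ ω ∂P, 0 < W.servingDist ω := by
  filter_upwards [W.bs_poisson.ae_notMem_of_volume_eq_zero (measurableSet_singleton 0)
    (measure_singleton 0)] with ω hω
  exact norm_pos_iff.2 (hω _)

lemma ae_distLaw_pos [IsProbabilityMeasure P] (j : LinkType) : ∀ᵐ r ∂(W.distLaw j), 0 < r := by
  rw [distLaw, ae_map_iff (W.aemeasurable_servingDist.mono_ac cond_absolutelyContinuous)
    measurableSet_Ioi]
  exact cond_absolutelyContinuous.ae_le W.ae_servingDist_pos

/-- The conditional secure connectivity probability when the link from the serving base station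
to the typical user has type `j` and length `r`. -/
noncomputable def secureProb (j : LinkType) (r : ℝ) : ℝ :=
  ∫ y, erlangTail (p.shape j) (p.arg j r * y.toReal) ∂(P.map W.IE)

variable [IsProbabilityMeasure P]

instance : IsProbabilityMeasure (P.map W.IE) :=
  Measure.isProbabilityMeasure_map W.hasLaplaceTransform_IE.aemeasurable

lemma measurable_secureProb (j : LinkType) : Measurable (W.secureProb j) := by
  have harg := p.measurable_arg j
  have htail := (continuous_erlangTail (p.shape j)).measurable
  have : Measurable fun x : ℝ × ℝ≥0∞ => erlangTail (p.shape j) (p.arg j x.1 * x.2.toReal) := by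
    fun_prop
  exact this.stronglyMeasurable.integral_prod_right.measurable

lemma secureProb_mem_Icc (j : LinkType) {r : ℝ} (hr : 0 < r) : W.secureProb j r ∈ Icc 0 1 := by
  have harg (y : ℝ≥0∞) : 0 ≤ p.arg j r * y.toReal :=
    mul_nonneg (p.arg_pos j hr).le ENNReal.toReal_nonneg
  refine ⟨integral_nonneg fun y => erlangTail_nonneg _ (harg y), ?_⟩
  refine (integral_mono_of_nonneg (.of_forall fun y => erlangTail_nonneg _ (harg y))
    (integrable_const 1) (.of_forall fun y => erlangTail_le_one _ (harg y))).trans ?_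
  simp

theorem secureProb_eq_sum (j : LinkType) {r : ℝ} (hr : 0 < r) :
    W.secureProb j r = ∑ m ∈ Finset.range (p.shape j),
      p.arg j r ^ m / m.factorial * (-1) ^ m * iteratedDeriv m p.expXi (p.arg j r) := by
  have htail := (continuous_erlangTail (p.shape j)).measurable
  rw [secureProb, integral_map W.hasLaplaceTransform_IE.aemeasurable
    (Measurable.aestronglyMeasurable (by fun_prop)),
    W.hasLaplaceTransform_IE.integral_erlangTail (p.arg_pos j hr)]

lemma tauTerm_eq_assocProb_mul_secureProb (j : LinkType) {r : ℝ} (hr : 0 < r) :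
    W.tauTerm j r = W.assocProb j * W.secureProb j r := by
  rw [tauTerm, W.secureProb_eq_sum j hr, Finset.mul_sum]
  refine Finset.sum_congr rfl fun m _ => ?_
  rw [Real.Gamma_nat_eq_factorial]
  ring

lemma lintegral_fadingLaw_setOf_one_le_div (i : ℕ) (x : Plane) (j : LinkType) {r : ℝ} (hr : 0 < r) :
    ∫⁻ z, p.fadingLaw {g | 1 ≤ ENNReal.ofReal (p.gain .main * p.pathLoss j r * g i j) /
        p.aggregate i x z} ∂(p.eveLaw W.eve P)
      = ENNReal.ofReal (W.secureProb j r) := by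
  have := p.isProbabilityMeasure_eveLaw W.eve_poisson
  have hlaplace := p.hasLaplaceTransform_aggregate W.eve_poisson i x
  have htail := (continuous_erlangTail (p.shape j)).measurable
  have harg (z : EveConfiguration) : 0 ≤ p.arg j r * (p.aggregate i x z).toReal :=
    mul_nonneg (p.arg_pos j hr).le ENNReal.toReal_nonneg
  have hint : Integrable (fun z => erlangTail (p.shape j)
      (p.arg j r * (p.aggregate i x z).toReal)) (p.eveLaw W.eve P) := by
    have hmeas := htail.comp_aemeasurable
      (hlaplace.aemeasurable.ennreal_toReal.const_mul (p.arg j r))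
    refine .of_bound hmeas.aestronglyMeasurable 1 (.of_forall fun z => ?_)
    rw [Real.norm_of_nonneg (erlangTail_nonneg _ (harg z))]
    exact erlangTail_le_one _ (harg z)
  rw [W.secureProb_eq_sum j hr, ← hlaplace.integral_erlangTail (p.arg_pos j hr),
    ofReal_integral_eq_lintegral_ofReal hint
      (.of_forall fun z => erlangTail_nonneg _ (harg z))]
  refine lintegral_congr_ae ?_
  filter_upwards [hlaplace.ae_lt_top] with z hz
  exact p.fadingLaw_setOf_one_le_div i j hr hz.ne

lemma measure_setOf_one_le_signalRatio {u : BaseConfiguration} (hu : 0 < p.servingDist u) :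
    ((p.eveLaw W.eve P).prod p.fadingLaw) {y | 1 ≤ p.signalRatio u y}
      = ENNReal.ofReal (W.secureProb (p.servingType u) (p.servingDist u)) := by
  have hratio : Measurable (p.signalRatio u) := by
    have := p.measurable_signalRatio
    fun_prop
  rw [Measure.prod_apply (measurableSet_le measurable_const hratio),
    ← W.lintegral_fadingLaw_setOf_one_le_div (p.servingIndex u) (u.1 (p.servingIndex u)) _ hu]
  rfl

lemma aemeasurable_secureProb_serving :
    AEMeasurable (fun ω => W.secureProb (W.servingType ω) (W.servingDist ω)) P := by
  have hsecure := W.measurable_secureProb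
  have h := p.measurable_comp_serving (u := id) (f := fun i j u => W.secureProb j ‖u.1 i‖)
    measurable_id (by fun_prop)
  have hserving := h.comp_aemeasurable W.hasLaw_base.aemeasurable
  exact hserving

lemma integrable_secureProb_serving :
    Integrable (fun ω => W.secureProb (W.servingType ω) (W.servingDist ω)) P := by
  refine .of_bound W.aemeasurable_secureProb_serving.aestronglyMeasurable 1 ?_
  filter_upwards [W.ae_servingDist_pos] with ω hω
  obtain ⟨h0, h1⟩ := W.secureProb_mem_Icc (W.servingType ω) hω
  rwa [Real.norm_of_nonneg h0]

theorem tauC_eq_integral_secureProb :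
    W.tauC = ∫ ω, W.secureProb (W.servingType ω) (W.servingDist ω) ∂P := by
  have := p.isProbabilityMeasure_eveLaw W.eve_poisson
  have hset : MeasurableSet {x : BaseConfiguration × EveConfiguration × (ℕ → LinkType → ℝ) |
      1 ≤ p.signalRatio x.1 x.2} :=
    measurableSet_le measurable_const p.measurable_signalRatio
  have hmeasure := W.hasLaw_base_environment.measure_eq hset
  rw [Measure.prod_apply hset, ← W.hasLaw_base.lintegral_comp
    (measurable_measure_prodMk_left hset).aemeasurable] at hmeasure
  have hnonneg : ∀ᵐ ω ∂P, 0 ≤ W.secureProb (W.servingType ω) (W.servingDist ω) := by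
    filter_upwards [W.ae_servingDist_pos] with ω hω
    exact (W.secureProb_mem_Icc _ hω).1
  rw [integral_eq_lintegral_of_nonneg_ae hnonneg
    W.aemeasurable_secureProb_serving.aestronglyMeasurable]
  refine congrArg ENNReal.toReal (hmeasure.trans (lintegral_congr_ae ?_))
  filter_upwards [W.ae_servingDist_pos] with ω hω
  have hfiber := W.measure_setOf_one_le_signalRatio (u := W.base ω) hω
  exact hfiber

instance (j : LinkType) : IsFiniteMeasure (W.distLaw j) := by
  unfold distLaw
  infer_instance

lemma tauTerm_ae_eq (j : LinkType) :
    W.tauTerm j =ᵐ[W.distLaw j] fun r => W.assocProb j * W.secureProb j r := by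
  filter_upwards [W.ae_distLaw_pos j] with r hr using W.tauTerm_eq_assocProb_mul_secureProb j hr

theorem integrable_tauTerm (j : LinkType) : Integrable (W.tauTerm j) (W.distLaw j) := by
  refine Integrable.congr (Integrable.const_mul ?_ _) (W.tauTerm_ae_eq j).symm
  refine .of_bound (W.measurable_secureProb j).aestronglyMeasurable 1 ?_
  filter_upwards [W.ae_distLaw_pos j] with r hr
  obtain ⟨h0, h1⟩ := W.secureProb_mem_Icc j hr
  rwa [Real.norm_of_nonneg h0]

theorem integral_tauTerm (j : LinkType) :
    ∫ r, W.tauTerm j r ∂(W.distLaw j) = ∫ ω in {ω | W.servingType ω = j},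
      W.secureProb (W.servingType ω) (W.servingDist ω) ∂P := by
  rw [integral_congr_ae (W.tauTerm_ae_eq j), integral_const_mul, distLaw,
    integral_map (W.aemeasurable_servingDist.mono_ac cond_absolutelyContinuous)
      (W.measurable_secureProb j).aestronglyMeasurable, assocProb,
    measureReal_mul_integral_cond]
  refine setIntegral_congr_ae₀ (W.nullMeasurableSet_servingType j) (.of_forall fun ω hω => ?_)
  rw [hω.symm]

theorem tauC_eq_sum_integral_tauTerm :
    W.tauC = ∑ j : LinkType, ∫ r, W.tauTerm j r ∂(W.distLaw j) := by
  have hnlos : {ω | W.servingType ω = .nlos} = {ω | W.servingType ω = .los}ᶜ := by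
    ext ω
    cases h : W.servingType ω <;> simp [h]
  simp_rw [W.integral_tauTerm]
  rw [LinkType.sum_univ, hnlos, integral_add_compl₀ (W.nullMeasurableSet_servingType .los)
    W.integrable_secureProb_serving, W.tauC_eq_integral_secureProb]

end Network

end MmWave

theorem theorem3 {Ω : Type*} [MeasurableSpace Ω] (P : Measure Ω) [IsProbabilityMeasure P]
    (p : MmWave.Params) (W : MmWave.Network p P) :
    (∀ᵐ ω ∂P, W.IE ω < ∞) ∧
    (∀ s : ℝ, 0 < s → W.laplaceIE s = Real.exp (p.Xi s)) ∧
    ContDiffOn ℝ (⊤ : ℕ∞) p.expXi (Ioi 0) ∧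
    (∀ j : MmWave.LinkType, Integrable (W.tauTerm j) (W.distLaw j)) ∧
    W.tauC = ∑ j : MmWave.LinkType, ∫ r, W.tauTerm j r ∂(W.distLaw j) :=
  ⟨W.hasLaplaceTransform_IE.ae_lt_top, W.hasLaplaceTransform_IE.integral_exp,
    W.hasLaplaceTransform_IE.contDiffOn, W.integrable_tauTerm, W.tauC_eq_sum_integral_tauTerm⟩
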